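/- **Histories and abstract executions.** Fix finite enumerated sets $\mathbb P=\{p_1,\dots,p_m\}$ (processes), $\mathbb T$ (types), $\mathbb O$ (objects), $\mathbb V$ (values). An operation $a$ has attributes $a.proc\in\mathbb P$, $a.type\in\mathbb T$, $a.obj\in\mathbb O$, $a.ival\in\mathbb V\cup\{\Phi\}$, $a.oval\in\mathbb V\cup\{\Phi,\nabla\}$, $a.stime\in\mathbb R_{>0}$ and $a.rtime\in\mathbb R\cup\{\infty\}$ with $a.stime<a.rtime$; if $a.rtime=\infty$ ($a$ does not return) then $a.oval=\nabla$. Write $a\xrightarrow{rb}b$ for $a.rtime<b.stime$, and call $a\ne b$ concurrent if neither $a\xrightarrow{rb}b$ nor $b\xrightarrow{rb}a$. A history is a set $H$ of operations such that every real number is the start or return time of at most one operation, and any two distinct operations of the same process are $rb$-related. An abstract execution $(H,ar,vis)$ is a history with a strict total order $ar$ on $H$ and an acyclic relation $vis$ on $H$. It is finite if $H$ is, and $\omega$-infinite if $H$ is infinite and for every $t$ only finitely many operations start before $t$. For $a\in H$ and $p\in\mathbb P$ let $b_0,b_1,\dots$ be the successive operations of $p$ that start after the return of $a$. For $k\ge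 1$, visibility is $k$-transient if for all $a$, $p$ and all $i\ge k$ for which $b_i$ exists, $a\xrightarrow{vis}b_i$ iff $a\xrightarrow{vis}b_{k-1}$. The execution is real-time if $a\xrightarrow{rb}b$ implies both $a\xrightarrow{ar}b$ and $\neg(b\xrightarrow{vis}a)$. **HistMSO.** Formulas are built with $\vee,\neg$ and quantifiers over operations ($\forall\mathsf a$) and sets of operations ($\forall A$) from the atoms $\mathsf a\in A$, $\mathsf a\xrightarrow{ar}\mathsf b$, $\mathsf a\xrightarrow{vis}\mathsf b$, equality of the processes, types, objects, times or (input or output) values of $\mathsf a$ and $\mathsf b$, $t<t'$ for $t,t'$ of the form $\mathsf a.stime$ or $\mathsf a.rtime$, $\mathsf a.proc=p$, $\mathsf a.type=\tau$, $\mathsf a.obj=o$, $\mathsf a.ival=\Phi$, $\mathsf a.oval=\Phi$, $\mathsf a.oval=\nabla$, with the usual satisfaction relation over $(H,ar,vis)$. **Encoding.** Let $t_0=0$ and let $t_1<t_2<\cdots$ enumerate the start times and finite return times of the operations of $H$. $\mathsf{Enc}(H,ar,vis)$ is the (finite or infinite) word whose letter at position $n$ is the bitvector consisting of the following bits for $t=t_n$;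 an attribute or relation bit is $0$ when the operations it refers to do not exist. - For each $i\le m$: whether some operation $a$ of $p_i$ has $a.stime\le t<a.rtime$. - Binary codes of the type and object of the operation that starts or returns at $t$, and of its input value if it starts at $t$, of its output value if it returns at $t$; the code of $\nabla$ is $0$. - If an operation $a$ of $p_i$ starts at $t$, for each other process $p_j$, with $b$ the last operation started on $p_j$ before $t$: one bit for $a\xrightarrow{ar}b$; and two bits saying whether $a,b$ are concurrent with $a\xrightarrow{vis}b$, respectively concurrent with $b\xrightarrow{vis}a$. - If an operation $a$ starts at $t$, for each process $p$ and each $r<k$: whether $b_r$ exists and $a\xrightarrow{vis}b_r$, where $b_0,b_1,\dots$ are the successive operations of $p$ that start after the return of $a$. **Translation.** MONA formulas are MSO formulas over $(\mathbb N,<)$ with one free set variable per line of the bitvectors; a word interprets it as the set of positions where that bit is $1$. First-order variables range over $\mathbb N$; set variables range over finite subsets of $\mathbb N$ for finite words and over all subsets for infinite words. $T$ commutes with $\vee$, $\neg$ and $\mathsf a\in A$, and relativises first-order quantifiers to the positions, and set quantifiers to the sets of positions, that satisfy $\mathsf{isStart}$ (the position is not $0$, and the only process bit that differs from the previous position is equal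 to $1$). The process of a start position is the one whose bit changes from $0$ to $1$ there; its return position is the first later position where that bit is $0$. Types, objects and input values are read at the start position, output values at the return position (as $\nabla$ if there is none); times are compared through positions, a missing return position counting as $\infty$. Arbitration is translated as the transitive closure of $rb\cup arc$, where $arc$ relates concurrent operations and is read from the arbitration bit at the later of the two start positions. Visibility is translated as $visc\cup visrb$, where $visc$ relates concurrent operations and is read from the visibility bits at the later of the two start positions, and, for $a\xrightarrow{rb}b$ with $b=b_i$ on its process, $a\xrightarrow{visrb}b$ is read at the start position of $a$ from the bit with index $r=\min(i,k-1)$. **Theorem.** Let $k\ge 1$. For every closed HistMSO formula $\varphi$ and every finite (respectively $\omega$-infinite) real-time abstract execution $(H,ar,vis)$ with $k$-transient visibility, $$(H,ar,vis)\models\varphi\iff \mathsf{Enc}(H,ar,vis)\models_{\mathsf{MONA}}T(\varphi).$$ -/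

import Mathlib

/-! ## Histories and abstract executions -/

/-- Input and output values: a value of `V`, the empty value `Φ`, or the mark `∇` of an
operation that does not return. -/
inductive OpValue (V : Type*) where
  | val (v : V)
  | phi
  | nabla

/-- An operation, with its process, type, object, input and output value, start time and return
time.  The return time is `⊤` when the operation does not return. -/
structure Operation (P T O V : Type*) where
  proc : P
  type : T
  obj : O
  ival : OpValue V
  oval : OpValue V
  stime : ℝ
  rtime : WithTop ℝ

/-- `a` returns before `b` starts. -/
def Operation.Rb {P T O V : Type*} (a b : Operation P T O V) : Prop :=
  a.rtime < (b.stime : WithTop ℝ)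

/-- Two operations are concurrent when they are distinct and overlap in time. -/
def Operation.Concurrent {P T O V : Type*} (a b : Operation P T O V) : Prop :=
  a ≠ b ∧ ¬ a.Rb b ∧ ¬ b.Rb a

/-- Histories: sets of operations in which every operation starts at a positive time and ends
after it starts, every timestamp is the extremity of at most one operation, and the operations
of each process do not overlap. -/
structure IsHistory {P T O V : Type*} (H : Set (Operation P T O V)) : Prop where
  stime_pos : ∀ a ∈ H, 0 < a.stime
  stime_lt_rtime : ∀ a ∈ H, (a.stime : WithTop ℝ) < a.rtime
  ival_ne_nabla : ∀ a ∈ H, a.ival ≠ OpValue.nabla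
  oval_of_pending : ∀ a ∈ H, a.rtime = ⊤ → a.oval = OpValue.nabla
  stime_inj : ∀ a ∈ H, ∀ b ∈ H, a.stime = b.stime → a = b
  rtime_inj : ∀ a ∈ H, ∀ b ∈ H, a.rtime ≠ ⊤ → a.rtime = b.rtime → a = b
  stime_ne_rtime : ∀ a ∈ H, ∀ b ∈ H, (a.stime : WithTop ℝ) ≠ b.rtime
  sequential : ∀ a ∈ H, ∀ b ∈ H, a.proc = b.proc → a ≠ b → a.Rb b ∨ b.Rb a

/-- An abstract execution: a history with an arbitration relation, which is a strict total order,
and a visibility relation, which is acyclic. -/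
structure AbstractExecution (P T O V : Type*) where
  ops : Set (Operation P T O V)
  isHistory : IsHistory ops
  ar : ops → ops → Prop
  vis : ops → ops → Prop
  ar_irrefl : ∀ a, ¬ ar a a
  ar_trans : ∀ a b c, ar a b → ar b c → ar a c
  ar_total : ∀ a b, a ≠ b → ar a b ∨ ar b a
  vis_acyclic : ∀ a, ¬ Relation.TransGen vis a a

namespace AbstractExecution

variable {P T O V : Type*} (X : AbstractExecution P T O V)

/-- Finite abstract executions. -/
def IsFinite : Prop := X.ops.Finite

/-- `ω`-infinite abstract executions: infinitely many operations, and (non-Zeno) only finitely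
many of them start before any given time. -/
def IsOmega : Prop := X.ops.Infinite ∧ ∀ t : ℝ, {a ∈ X.ops | a.stime ≤ t}.Finite

/-- Real-time arbitration: `rb ⊆ ar`. -/
def RealTimeArbitration : Prop := ∀ a b : X.ops, a.1.Rb b.1 → X.ar a b

/-- Visibility respects real time: no operation is visible to one that returned before it
started. -/
def RealTimeVisibility : Prop := ∀ a b : X.ops, a.1.Rb b.1 → ¬ X.vis b a

/-- `b` is the direct successor of `a` on process `p` for the returns-before order. -/
def DirectSucc (p : P) (a b : X.ops) : Prop :=
  b.1.proc = p ∧ a.1.Rb b.1 ∧ ¬ ∃ c : X.ops, c.1.proc = b.1.proc ∧ a.1.Rb c.1 ∧ c.1.Rb b.1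

/-- `X.NthSucc p a i b`: in the chain `b₀, b₁, …` of direct successors on process `p` that
begins with the direct successor `b₀` of `a`, the operation `bᵢ` is `b`. -/
def NthSucc (p : P) (a : X.ops) : ℕ → X.ops → Prop
  | 0, b => X.DirectSucc p a b
  | i + 1, b => ∃ c : X.ops, NthSucc p a i c ∧ X.DirectSucc p c b

/-- `k`-transient visibility (for `k ≥ 1`): for all `a` and `p`, and for all `i ≥ k`, `a` is
visible to `bᵢ` iff it is visible to `bₖ₋₁`. -/
def Transient (k : ℕ) : Prop :=
  ∀ (a : X.ops) (p : P) (i : ℕ), k ≤ i → ∀ b c : X.ops,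
    X.NthSucc p a (k - 1) b → X.NthSucc p a i c → (X.vis a c ↔ X.vis a b)

end AbstractExecution

/-! ## The logic HistMSO -/

/-- The terms `x.stime` and `x.rtime`. -/
inductive TimeTerm where
  | stime (x : ℕ)
  | rtime (x : ℕ)

/-- The terms `x.ival` and `x.oval`. -/
inductive ValueTerm where
  | ival (x : ℕ)
  | oval (x : ℕ)

/-- Formulas of HistMSO; first-order and second-order variables are named by natural numbers. -/
inductive HistMSO (P T O : Type*) where
  | eqProc (x y : ℕ)
  | eqType (x y : ℕ)
  | eqObj (x y : ℕ)
  | eqValue (s t : ValueTerm)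
  | eqTime (s t : TimeTerm)
  | ltTime (s t : TimeTerm)
  | procIs (x : ℕ) (p : P)
  | typeIs (x : ℕ) (τ : T)
  | objIs (x : ℕ) (o : O)
  | ivalIsPhi (x : ℕ)
  | ovalIsPhi (x : ℕ)
  | ovalIsNabla (x : ℕ)
  | or (φ ψ : HistMSO P T O)
  | neg (φ : HistMSO P T O)
  | all₁ (x : ℕ) (φ : HistMSO P T O)
  | all₂ (A : ℕ) (φ : HistMSO P T O)
  | mem (x A : ℕ)
  | ar (x y : ℕ)
  | vis (x y : ℕ)

/-- The first-order variable of a time term. -/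
def TimeTerm.var : TimeTerm → ℕ
  | stime x => x
  | rtime x => x

/-- The first-order variable of a value term. -/
def ValueTerm.var : ValueTerm → ℕ
  | ival x => x
  | oval x => x

namespace HistMSO

variable {P T O V : Type*}

/-- Free first-order variables. -/
def free₁ : HistMSO P T O → Finset ℕ
  | eqProc x y => {x, y}
  | eqType x y => {x, y}
  | eqObj x y => {x, y}
  | eqValue s t => {s.var, t.var}
  | eqTime s t => {s.var, t.var}
  | ltTime s t => {s.var, t.var}
  | procIs x _ => {x}
  | typeIs x _ => {x}
  | objIs x _ => {x}
  | ivalIsPhi x => {x}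
  | ovalIsPhi x => {x}
  | ovalIsNabla x => {x}
  | or φ ψ => free₁ φ ∪ free₁ ψ
  | neg φ => free₁ φ
  | all₁ x φ => (free₁ φ).erase x
  | all₂ _ φ => free₁ φ
  | mem x _ => {x}
  | ar x y => {x, y}
  | vis x y => {x, y}

/-- Free second-order variables. -/
def free₂ : HistMSO P T O → Finset ℕ
  | or φ ψ => free₂ φ ∪ free₂ ψ
  | neg φ => free₂ φ
  | all₁ _ φ => free₂ φ
  | all₂ A φ => (free₂ φ).erase A
  | mem _ A => {A}
  | _ => ∅

/-- A formula is closed when it has no free variable. -/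
def IsClosed (φ : HistMSO P T O) : Prop := φ.free₁ = ∅ ∧ φ.free₂ = ∅

end HistMSO

/-- The value of a time term under a partial assignment. -/
def TimeTerm.eval {P T O V : Type*} {X : AbstractExecution P T O V} (υ : ℕ → Option X.ops) :
    TimeTerm → Option (WithTop ℝ)
  | stime x => (υ x).map fun a => (a.1.stime : WithTop ℝ)
  | rtime x => (υ x).map fun a => a.1.rtime

/-- The value of a value term under a partial assignment. -/
def ValueTerm.eval {P T O V : Type*} {X : AbstractExecution P T O V} (υ : ℕ → Option X.ops) :
    ValueTerm → Option (OpValue V)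
  | ival x => (υ x).map fun a => a.1.ival
  | oval x => (υ x).map fun a => a.1.oval

namespace AbstractExecution

variable {P T O V : Type*} (X : AbstractExecution P T O V)

/-- Satisfaction of a formula under an assignment of operations to first-order variables (a
partial map, since a history may be empty) and of sets of operations to second-order variables.
An atomic formula only holds if its variables are assigned. -/
def Sat (υ : ℕ → Option X.ops) (Υ : ℕ → Set X.ops) : HistMSO P T O → Prop
  | .eqProc x y => ∃ a ∈ υ x, ∃ b ∈ υ y, a.1.proc = b.1.proc
  | .eqType x y => ∃ a ∈ υ x, ∃ b ∈ υ y, a.1.type = b.1.type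
  | .eqObj x y => ∃ a ∈ υ x, ∃ b ∈ υ y, a.1.obj = b.1.obj
  | .eqValue s t => ∃ u ∈ s.eval υ, ∃ v ∈ t.eval υ, u = v
  | .eqTime s t => ∃ u ∈ s.eval υ, ∃ v ∈ t.eval υ, u = v
  | .ltTime s t => ∃ u ∈ s.eval υ, ∃ v ∈ t.eval υ, u < v
  | .procIs x p => ∃ a ∈ υ x, a.1.proc = p
  | .typeIs x τ => ∃ a ∈ υ x, a.1.type = τ
  | .objIs x o => ∃ a ∈ υ x, a.1.obj = o
  | .ivalIsPhi x => ∃ a ∈ υ x, a.1.ival = OpValue.phi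
  | .ovalIsPhi x => ∃ a ∈ υ x, a.1.oval = OpValue.phi
  | .ovalIsNabla x => ∃ a ∈ υ x, a.1.oval = OpValue.nabla
  | .or φ ψ => Sat υ Υ φ ∨ Sat υ Υ ψ
  | .neg φ => ¬ Sat υ Υ φ
  | .all₁ x φ => ∀ a : X.ops, Sat (Function.update υ x (some a)) Υ φ
  | .all₂ A φ => ∀ S : Set X.ops, Sat υ (Function.update Υ A S) φ
  | .mem x A => ∃ a ∈ υ x, a ∈ Υ A
  | .ar x y => ∃ a ∈ υ x, ∃ b ∈ υ y, X.ar a b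
  | .vis x y => ∃ a ∈ υ x, ∃ b ∈ υ y, X.vis a b

/-- Satisfaction of a closed formula: no variable is assigned at the start. -/
def Models (φ : HistMSO P T O) : Prop := X.Sat (fun _ => none) (fun _ => ∅) φ

end AbstractExecution

/-! ## MONA: monadic second-order logic over the natural numbers -/

/-- MONA formulas with first-order variables named by natural numbers and second-order variables
in `S`. -/
inductive Mona (S : Type*) where
  | lt (x y : ℕ)
  | mem (x : ℕ) (A : S)
  | neg (φ : Mona S)
  | and (φ ψ : Mona S)
  | ex₁ (x : ℕ) (φ : Mona S)
  | ex₂ (A : S) (φ : Mona S)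

namespace Mona

variable {S L : Type*}

/-- Satisfaction, where second-order quantifiers range over the sets in `D`. -/
def Sat [DecidableEq S] (D : Set (Set ℕ)) (v : ℕ → ℕ) (W : S → Set ℕ) : Mona S → Prop
  | lt x y => v x < v y
  | mem x A => v x ∈ W A
  | neg φ => ¬ Sat D v W φ
  | and φ ψ => Sat D v W φ ∧ Sat D v W ψ
  | ex₁ x φ => ∃ n : ℕ, Sat D (Function.update v x n) W φ
  | ex₂ A φ => ∃ Q ∈ D, Sat D v (Function.update W A Q) φ

/-- A finite word of bitvectors with lines in `L` satisfies a formula whose only free variables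
are the line variables `Sum.inl ℓ`: that variable is interpreted as the set of the positions
whose letter has bit `ℓ` equal to `1` (the values of the other variables are irrelevant).
First-order variables range over the natural numbers and second-order variables over the finite
sets of natural numbers. -/
def ModelsFinite [DecidableEq L] (w : List (L → Bool)) (φ : Mona (L ⊕ ℕ)) : Prop :=
  ∀ (v : ℕ → ℕ) (W : L ⊕ ℕ → Set ℕ),
    (∀ ℓ, W (Sum.inl ℓ) = {i | ∃ h : i < w.length, w[i] ℓ = true}) →
      Sat {Q | Q.Finite} v W φ

/-- The same for infinite words, second-order variables ranging over all sets of natural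
numbers. -/
def ModelsOmega [DecidableEq L] (w : ℕ → L → Bool) (φ : Mona (L ⊕ ℕ)) : Prop :=
  ∀ (v : ℕ → ℕ) (W : L ⊕ ℕ → Set ℕ),
    (∀ ℓ, W (Sum.inl ℓ) = {i | w i ℓ = true}) → Sat Set.univ v W φ

/-! ### Macros -/

def or (φ ψ : Mona S) : Mona S := neg (and (neg φ) (neg ψ))

def imp (φ ψ : Mona S) : Mona S := neg (and φ (neg ψ))

def iff (φ ψ : Mona S) : Mona S := and (imp φ ψ) (imp ψ φ)

def all₁ (x : ℕ) (φ : Mona S) : Mona S := neg (ex₁ x (neg φ))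

def all₂ (A : S) (φ : Mona S) : Mona S := neg (ex₂ A (neg φ))

def fls : Mona S := ex₁ 0 (lt 0 0)

def eq (x y : ℕ) : Mona S := and (neg (lt x y)) (neg (lt y x))

/-- Finite disjunction. -/
def bigOr {n : ℕ} (f : Fin n → Mona S) : Mona S := ((List.finRange n).map f).foldr or fls

/-- Finite conjunction. -/
def bigAnd {n : ℕ} (f : Fin n → Mona S) : Mona S :=
  ((List.finRange n).map f).foldr and (neg fls)

/-- `φ` if `b` is true, and its negation otherwise. -/
def lit (b : Bool) (φ : Mona S) : Mona S := if b then φ else neg φ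

/-- A variable distinct from `x` and `y`. -/
def fresh (x y : ℕ) : ℕ := max x y + 1

/-- `y` is the position next to `x`. -/
def next (x y : ℕ) : Mona S :=
  and (lt x y) (neg (ex₁ (fresh x y) (and (lt x (fresh x y)) (lt (fresh x y) y))))

end Mona

/-! ## Encoding abstract executions as words -/

/-- Enumerations of the finite sets of processes, types, objects and values. -/
structure Enumeration (P T O V : Type*) where
  m : ℕ
  nT : ℕ
  nO : ℕ
  nV : ℕ
  proc : P ≃ Fin m
  type : T ≃ Fin nT
  obj : O ≃ Fin nO
  val : V ≃ Fin nV

/-- The code of a value, among `nV + 2` codes. -/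
def Enumeration.valueCode {P T O V : Type*} (E : Enumeration P T O V) : OpValue V → ℕ
  | .nabla => 0
  | .phi => 1
  | .val v => (E.val v : ℕ) + 2

/-- The lines of the bitvectors.
`active`: activity of each process.
`type`, `value`, `obj`: binary codes of the attributes.
`ar`, `visTo`, `visFrom`: arbitration, and visibility in either direction, between the operation
that starts and the last operation started on each other process.
`visRb`: visibility of the operation that starts to the first `k` operations started on each
process after its return. -/
inductive Line (m nT nO nV k : ℕ) where
  | active (i : Fin m)
  | type (j : Fin (Nat.clog 2 nT))
  | value (j : Fin (Nat.clog 2 (nV + 2)))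
  | obj (j : Fin (Nat.clog 2 nO))
  | ar (j : Fin (m - 1))
  | visTo (j : Fin (m - 1))
  | visFrom (j : Fin (m - 1))
  | visRb (i : Fin m) (r : Fin k)
deriving DecidableEq

/-- The `j`-th process when process `i` is skipped. -/
def skipProc {m : ℕ} (i : Fin m) (j : Fin (m - 1)) : Fin m :=
  if j.val < i.val then ⟨j.val, by omega⟩ else ⟨j.val + 1, by omega⟩

namespace Enumeration

variable {P T O V : Type*} (E : Enumeration P T O V)

/-- The lines for the enumeration `E` and the bound `k`. -/
abbrev Lines (k : ℕ) : Type := Line E.m E.nT E.nO E.nV k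

end Enumeration

namespace AbstractExecution

variable {P T O V : Type*} (X : AbstractExecution P T O V) (E : Enumeration P T O V)

/-- The starting and return times of the operations. -/
def extremities : Set ℝ := {t | ∃ a ∈ X.ops, a.stime = t ∨ a.rtime = (t : WithTop ℝ)}

/-- The timestamps at which snapshots are taken: first `0`, then the extremities of the
operations in increasing order. -/
noncomputable def timestamp : ℕ → ℝ
  | 0 => 0
  | n + 1 => sInf {t ∈ X.extremities | timestamp n < t}

/-- `b` is the last operation started before time `t` on process `p`. -/
def LastStarted (p : P) (t : ℝ) (b : X.ops) : Prop :=
  b.1.proc = p ∧ b.1.stime < t ∧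
    ∀ c : X.ops, c.1.proc = p → c.1.stime < t → c.1.stime ≤ b.1.stime

/-- The bits that are equal to `1` in the letter for time `t`. -/
def Bit (k : ℕ) (t : ℝ) : E.Lines k → Prop
  | .active i => ∃ a : X.ops, E.proc a.1.proc = i ∧ a.1.stime ≤ t ∧ (t : WithTop ℝ) < a.1.rtime
  | .type j => ∃ a : X.ops, (a.1.stime = t ∨ a.1.rtime = (t : WithTop ℝ)) ∧
      (E.type a.1.type : ℕ).testBit j = true
  | .value j => ∃ a : X.ops,
      (a.1.stime = t ∧ (E.valueCode a.1.ival).testBit j = true) ∨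
      (a.1.rtime = (t : WithTop ℝ) ∧ (E.valueCode a.1.oval).testBit j = true)
  | .obj j => ∃ a : X.ops, (a.1.stime = t ∨ a.1.rtime = (t : WithTop ℝ)) ∧
      (E.obj a.1.obj : ℕ).testBit j = true
  | .ar j => ∃ a b : X.ops, a.1.stime = t ∧
      X.LastStarted (E.proc.symm (skipProc (E.proc a.1.proc) j)) t b ∧ X.ar a b
  | .visTo j => ∃ a b : X.ops, a.1.stime = t ∧
      X.LastStarted (E.proc.symm (skipProc (E.proc a.1.proc) j)) t b ∧
      a.1.Concurrent b.1 ∧ X.vis a b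
  | .visFrom j => ∃ a b : X.ops, a.1.stime = t ∧
      X.LastStarted (E.proc.symm (skipProc (E.proc a.1.proc) j)) t b ∧
      a.1.Concurrent b.1 ∧ X.vis b a
  | .visRb i r => ∃ a b : X.ops, a.1.stime = t ∧
      X.NthSucc (E.proc.symm i) a r b ∧ X.vis a b

open Classical in
/-- The bitvector for time `t`. -/
noncomputable def letter (k : ℕ) (t : ℝ) : E.Lines k → Bool := fun ℓ => decide (X.Bit E k t ℓ)

/-- The encoding of a finite abstract execution: a finite word. -/
noncomputable def encFinite (k : ℕ) : List (E.Lines k → Bool) :=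
  (List.range (X.extremities.ncard + 1)).map fun i => X.letter E k (X.timestamp i)

/-- The encoding of an `ω`-infinite abstract execution: an infinite word. -/
noncomputable def encOmega (k : ℕ) : ℕ → E.Lines k → Bool :=
  fun i => X.letter E k (X.timestamp i)

end AbstractExecution

/-! ## Translating HistMSO to MONA -/

namespace Enumeration

variable {P T O V : Type*} (E : Enumeration P T O V) (k : ℕ)

open Mona

/-- The MONA formulas over the line variables `Sum.inl ℓ`; the second-order variable `A` of
HistMSO is written `Sum.inr A`. -/
abbrev Form : Type := Mona (E.Lines k ⊕ ℕ)

/-- The bit of position `x` on line `ℓ` is `1`. -/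
def bit (x : ℕ) (ℓ : E.Lines k) : E.Form k := mem x (Sum.inl ℓ)

/-- An operation on process `i` starts at position `x`: the bit of that process is `1` at `x` and
`0` at the position before `x`. -/
def startOn (i : Fin E.m) (x : ℕ) : E.Form k :=
  ex₁ (x + 1) (and (next (x + 1) x)
    (and (neg (E.bit k (x + 1) (.active i))) (E.bit k x (.active i))))

/-- `x ≠ 0` and the only process bit that differs between `x - 1` and `x` is `1` at `x`. -/
def isStart (x : ℕ) : E.Form k :=
  ex₁ (x + 1) (and (next (x + 1) x)
    (bigOr fun i : Fin E.m => and
      (and (neg (E.bit k (x + 1) (.active i))) (E.bit k x (.active i)))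
      (bigAnd fun j : Fin E.m => if j = i then neg fls else
        iff (E.bit k (x + 1) (.active j)) (E.bit k x (.active j)))))

/-- `y` is the first position after `x` where the bit of the process of `x` is `0`. -/
def returnsAt (x y : ℕ) : E.Form k :=
  bigOr fun i : Fin E.m => and (E.startOn k i x) (and (lt x y)
    (and (neg (E.bit k y (.active i)))
      (all₁ (fresh x y) (imp (and (lt x (fresh x y)) (lt (fresh x y) y))
        (E.bit k (fresh x y) (.active i))))))

/-- `y` is the position of the timestamp denoted by the term `s`. -/
def timeAt (s : TimeTerm) (y : ℕ) : E.Form k :=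
  match s with
  | .stime x => eq x y
  | .rtime x => E.returnsAt k x y

/-- Comparison of time terms, a missing return position standing for an infinite return time. -/
def trLt (s t : TimeTerm) : E.Form k :=
  ex₁ (fresh s.var t.var) (and (E.timeAt k s (fresh s.var t.var))
    (all₁ (fresh s.var t.var + 1) (imp (E.timeAt k t (fresh s.var t.var + 1))
      (lt (fresh s.var t.var) (fresh s.var t.var + 1)))))

/-- The returns-before relation. -/
def trRb (x y : ℕ) : E.Form k := E.trLt k (.rtime x) (.stime y)

/-- The `j`-th bit of the code of a value term is `1`.  Input values are read where the operation
starts, output values where it returns. -/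
def valueBit (s : ValueTerm) (j : Fin (Nat.clog 2 (E.nV + 2))) : E.Form k :=
  match s with
  | .ival x => E.bit k x (.value j)
  | .oval x => ex₁ (x + 1) (and (E.returnsAt k x (x + 1)) (E.bit k (x + 1) (.value j)))

/-- The code of a value term is `c`. -/
def valueIs (s : ValueTerm) (c : ℕ) : E.Form k :=
  bigAnd fun j => lit (c.testBit j) (E.valueBit k s j)

/-- The operations that start at `x` and `y` are concurrent. -/
def trConc (x y : ℕ) : E.Form k :=
  and (neg (eq x y)) (and (neg (E.trRb k x y)) (neg (E.trRb k y x)))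

/-- The bit of position `x` on the line, among those given by `ℓ`, of the process of `y`. -/
def pairBit (ℓ : Fin (E.m - 1) → E.Lines k) (x y : ℕ) : E.Form k :=
  bigOr fun i : Fin E.m => bigOr fun j : Fin (E.m - 1) =>
    and (E.startOn k i x) (and (E.startOn k (skipProc i j) y) (E.bit k x (ℓ j)))

/-- Arbitration between concurrent operations. -/
def trArc (x y : ℕ) : E.Form k :=
  and (E.trConc k x y) (or (and (lt y x) (E.pairBit k .ar x y))
    (and (lt x y) (neg (E.pairBit k .ar y x))))

/-- Arbitration: the transitive closure of returns-before and arbitration between concurrent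
operations. -/
def trAr (x y : ℕ) : E.Form k :=
  all₂ (Sum.inr 0) (imp
    (all₁ (fresh x y) (all₁ (fresh x y + 1) (imp
      (and (and (E.isStart k (fresh x y)) (E.isStart k (fresh x y + 1)))
        (and (or (eq (fresh x y) x) (mem (fresh x y) (Sum.inr 0)))
          (or (E.trRb k (fresh x y) (fresh x y + 1)) (E.trArc k (fresh x y) (fresh x y + 1)))))
      (mem (fresh x y + 1) (Sum.inr 0)))))
    (mem y (Sum.inr 0)))

/-- Visibility between concurrent operations. -/
def trVisc (x y : ℕ) : E.Form k :=
  and (E.trConc k x y) (or (and (lt y x) (E.pairBit k .visTo x y))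
    (and (lt x y) (E.pairBit k .visFrom y x)))

/-- `y` is the direct successor of `x` on process `i`. -/
def trDirectSucc (i : Fin E.m) (x y : ℕ) : E.Form k :=
  and (E.startOn k i y) (and (E.trRb k x y)
    (neg (ex₁ (fresh x y) (and (E.startOn k i (fresh x y))
      (and (E.trRb k x (fresh x y)) (E.trRb k (fresh x y) y))))))

/-- `y` is number `r` in the chain of direct successors of `x` on process `i`. -/
def trNthSucc (i : Fin E.m) (x : ℕ) : ℕ → ℕ → E.Form k
  | 0, y => E.trDirectSucc k i x y
  | r + 1, y => ex₁ (fresh x y)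
      (and (trNthSucc i x r (fresh x y)) (E.trDirectSucc k i (fresh x y) y))

/-- Visibility of `x` to `y` when `x` returns before `y` starts: it is read on the line of `y`
if `y` is among the first `k` successors of `x` on its process, and on the line of the `k`-th
successor if `y` comes after it. -/
def trVisRb (x y : ℕ) : E.Form k :=
  bigOr fun i : Fin E.m => bigOr fun r : Fin k => and (E.bit k x (.visRb i r))
    (if r.val + 1 = k then
      or (E.trNthSucc k i x r y) (ex₁ (fresh x y) (and (E.startOn k i y)
        (and (E.trNthSucc k i x r (fresh x y)) (E.trRb k (fresh x y) y))))
    else E.trNthSucc k i x r y)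

/-- The translation of HistMSO formulas to MONA formulas. -/
def translate : HistMSO P T O → E.Form k
  | .eqProc x y => bigOr fun i : Fin E.m => and (E.startOn k i x) (E.startOn k i y)
  | .eqType x y => bigAnd fun j => iff (E.bit k x (.type j)) (E.bit k y (.type j))
  | .eqObj x y => bigAnd fun j => iff (E.bit k x (.obj j)) (E.bit k y (.obj j))
  | .eqValue s t => bigAnd fun j => iff (E.valueBit k s j) (E.valueBit k t j)
  | .eqTime s t => and (neg (E.trLt k s t)) (neg (E.trLt k t s))
  | .ltTime s t => E.trLt k s t
  | .procIs x p => E.startOn k (E.proc p) x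
  | .typeIs x τ => bigAnd fun j => lit ((E.type τ : ℕ).testBit j) (E.bit k x (.type j))
  | .objIs x o => bigAnd fun j => lit ((E.obj o : ℕ).testBit j) (E.bit k x (.obj j))
  | .ivalIsPhi x => E.valueIs k (.ival x) (E.valueCode .phi)
  | .ovalIsPhi x => E.valueIs k (.oval x) (E.valueCode .phi)
  | .ovalIsNabla x => E.valueIs k (.oval x) (E.valueCode .nabla)
  | .or φ ψ => Mona.or (translate φ) (translate ψ)
  | .neg φ => Mona.neg (translate φ)
  | .all₁ x φ => Mona.all₁ x (imp (E.isStart k x) (translate φ))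
  | .all₂ A φ => Mona.all₂ (Sum.inr A)
      (imp (Mona.all₁ 0 (imp (Mona.mem 0 (Sum.inr A)) (E.isStart k 0))) (translate φ))
  | .mem x A => Mona.mem x (Sum.inr A)
  | .ar x y => E.trAr k x y
  | .vis x y => Mona.or (E.trVisc k x y) (E.trVisRb k x y)

end Enumeration

/-! The encoding forgets real times but keeps their order. As finitely many operations start before
any given time, the timestamps list all extremities in increasing order. An operation is then
faithfully represented by the position of its start (`pos` is injective) and a set of operations by
its image. Two consecutive timestamps enclose no extremity and an extremity belongs to one
operation, so `isStart` holds exactly on the range of `pos` (`Reads.sat_isStart`). The theorem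
follows by induction on formulas (`Reads.sat_translate`), with the invariant that free variables
denote the images of the objects assigned to them. The relativised quantifiers preserve it, and the
substance lies in the atoms.

For times, a return is the first later zero of the process bit (`Reads.sat_returnsAt`). A pending
operation has no such position in an infinite word; in a finite word it has the first position past
the end, where all lines read `0`. The comparison of times is correct in both situations
(`NonZeno.lt_iff_exists_isPos`).

For relations, a letter compares an operation only with the last one started on each other process.
This suffices for concurrent pairs (`lastStarted_of_concurrent`). All other pairs of distinct
operations are ordered by returns-before. Real-time arbitration settles them for `ar`, which is thus
already the union of returns-before and concurrent arbitration, and taking the transitive closure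
adds nothing (`Reads.sat_trAr`). Visibility against real time is excluded, and visibility along real
time is determined by the first `k` successors, by transience (`Transient.vis_iff`).

The range `D` of set quantifiers stays a parameter, required only to contain the images of all sets
of operations, so that finite and infinite words share one proof. -/

/-! ## Satisfaction of the MONA macros -/

namespace Mona

variable {S : Type*}

theorem left_ne_fresh (x y : ℕ) : x ≠ fresh x y := by unfold fresh; omega

theorem right_ne_fresh (x y : ℕ) : y ≠ fresh x y := by unfold fresh; omega

theorem left_ne_fresh_succ (x y : ℕ) : x ≠ fresh x y + 1 := by unfold fresh; omega

theorem right_ne_fresh_succ (x y : ℕ) : y ≠ fresh x y + 1 := by unfold fresh; omega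

variable [DecidableEq S] {D : Set (Set ℕ)} {v : ℕ → ℕ} {W : S → Set ℕ} {φ ψ : Mona S}

theorem sat_or : Sat D v W (or φ ψ) ↔ Sat D v W φ ∨ Sat D v W ψ := by
  simp only [or, Sat]; tauto

theorem sat_imp : Sat D v W (imp φ ψ) ↔ (Sat D v W φ → Sat D v W ψ) := by
  simp only [imp, Sat]; tauto

theorem sat_iff : Sat D v W (iff φ ψ) ↔ (Sat D v W φ ↔ Sat D v W ψ) := by
  simp only [iff, Sat, sat_imp]; tauto

theorem sat_all₁ {x : ℕ} :
    Sat D v W (all₁ x φ) ↔ ∀ n : ℕ, Sat D (Function.update v x n) W φ := by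
  simp only [all₁, Sat, not_exists, not_not]

theorem sat_all₂ {A : S} :
    Sat D v W (all₂ A φ) ↔ ∀ Q ∈ D, Sat D v (Function.update W A Q) φ := by
  simp only [all₂, Sat, not_exists, not_and, not_not]

theorem not_sat_fls : ¬ Sat D v W fls := by
  simp [fls, Sat]

theorem sat_eq {x y : ℕ} : Sat D v W (eq x y) ↔ v x = v y := by
  simp only [eq, Sat]; omega

theorem sat_bigOr {n : ℕ} {f : Fin n → Mona S} :
    Sat D v W (bigOr f) ↔ ∃ i, Sat D v W (f i) := by
  have key : ∀ l : List (Fin n),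
      Sat D v W ((l.map f).foldr or fls) ↔ ∃ i ∈ l, Sat D v W (f i) := by
    intro l
    induction l with
    | nil => simp [not_sat_fls]
    | cons a l ih => simp [sat_or, ih]
  simp [bigOr, key]

theorem sat_bigAnd {n : ℕ} {f : Fin n → Mona S} :
    Sat D v W (bigAnd f) ↔ ∀ i, Sat D v W (f i) := by
  have key : ∀ l : List (Fin n),
      Sat D v W ((l.map f).foldr and (neg fls)) ↔ ∀ i ∈ l, Sat D v W (f i) := by
    intro l
    induction l with
    | nil => simp [Sat, not_sat_fls]
    | cons a l ih => simp [Sat, ih]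
  simp [bigAnd, key]

theorem sat_lit {b : Bool} : Sat D v W (lit b φ) ↔ (Sat D v W φ ↔ b = true) := by
  cases b <;> simp [lit, Sat]

theorem sat_next {x y : ℕ} : Sat D v W (next x y) ↔ v y = v x + 1 := by
  simp only [next, Sat, Function.update_self, Function.update_of_ne (left_ne_fresh x y),
    Function.update_of_ne (right_ne_fresh x y)]
  constructor
  · rintro ⟨h, h'⟩
    by_contra hne
    exact h' ⟨v x + 1, by omega, by omega⟩
  · intro h
    exact ⟨by omega, by rintro ⟨n, h1, h2⟩; omega⟩

end Mona

/-! ## Timestamps enumerate the extremities -/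

namespace AbstractExecution

variable {P T O V : Type*} (X : AbstractExecution P T O V)

/-- Only finitely many operations start before any given time. -/
def NonZeno : Prop := ∀ t : ℝ, {a ∈ X.ops | a.stime ≤ t}.Finite

/-- The positions that carry a meaningful timestamp. -/
def domain : Set ℕ := {n | ∀ i < n, ∃ t ∈ X.extremities, X.timestamp i < t}

variable {X}

theorem stime_mem_extremities (a : X.ops) : a.1.stime ∈ X.extremities := ⟨a.1, a.2, Or.inl rfl⟩

theorem rtime_mem_extremities {a : X.ops} {t : ℝ} (h : a.1.rtime = (t : WithTop ℝ)) :
    t ∈ X.extremities := ⟨a.1, a.2, Or.inr h⟩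

theorem extremities_pos {t : ℝ} (ht : t ∈ X.extremities) : 0 < t := by
  obtain ⟨a, ha, h | h⟩ := ht
  · exact h ▸ X.isHistory.stime_pos a ha
  · have h1 := X.isHistory.stime_lt_rtime a ha
    rw [h, WithTop.coe_lt_coe] at h1
    exact (X.isHistory.stime_pos a ha).trans h1

/-- An extremity up to `s` belongs to an operation started by `s`, and each operation has at most
two. The default of `untopD` only produces a superfluous point. -/
theorem NonZeno.finite_extremities_le (hF : X.NonZeno) (s : ℝ) :
    {t ∈ X.extremities | t ≤ s}.Finite := by
  refine (((hF s).image fun a => a.stime).union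
    ((hF s).image fun a => a.rtime.untopD 0)).subset ?_
  rintro t ⟨⟨a, ha, h | h⟩, hts⟩
  · exact Or.inl ⟨a, ⟨ha, h ▸ hts⟩, h⟩
  · have h1 := X.isHistory.stime_lt_rtime a ha
    rw [h, WithTop.coe_lt_coe] at h1
    exact Or.inr ⟨a, ⟨ha, (h1.trans_le hts).le⟩, by simp [h]⟩

theorem domain_lower {i n : ℕ} (hn : n ∈ X.domain) (h : i ≤ n) : i ∈ X.domain :=
  fun j hj => hn j (hj.trans_le h)

theorem zero_mem_domain : 0 ∈ X.domain := fun i hi => absurd hi i.not_lt_zero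

theorem succ_mem_domain {n : ℕ} {t : ℝ} (hn : n ∈ X.domain) (ht : t ∈ X.extremities)
    (h : X.timestamp n < t) : n + 1 ∈ X.domain := by
  intro i hi
  rcases Nat.lt_succ_iff_lt_or_eq.1 hi with h' | rfl
  · exact hn i h'
  · exact ⟨t, ht, h⟩

/-- Below any later extremity `s` there are finitely many others, so the infimum defining the
timestamp is attained. Outside the domain it is the infimum of a set that may be empty, a junk
value. -/
theorem NonZeno.isLeast_timestamp (hF : X.NonZeno) {n : ℕ} (hn : n + 1 ∈ X.domain) :
    IsLeast {t ∈ X.extremities | X.timestamp n < t} (X.timestamp (n + 1)) := by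
  obtain ⟨s, hs, hns⟩ := hn n n.lt_succ_self
  obtain ⟨m, ⟨⟨hm, hms⟩, hnm⟩, hmin⟩ := Set.exists_min_image
    {t | (t ∈ X.extremities ∧ t ≤ s) ∧ X.timestamp n < t} id
    ((hF.finite_extremities_le s).subset fun t ht => ht.1) ⟨s, ⟨hs, le_rfl⟩, hns⟩
  have hleast : IsLeast {t ∈ X.extremities | X.timestamp n < t} m := by
    refine ⟨⟨hm, hnm⟩, fun t ht => ?_⟩
    rcases le_total t s with h | h
    · exact hmin t ⟨⟨ht.1, h⟩, ht.2⟩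
    · exact hms.trans h
  have : X.timestamp (n + 1) = m := by
    rw [timestamp]
    exact hleast.csInf_eq
  rwa [this]

theorem NonZeno.timestamp_lt (hF : X.NonZeno) {i n : ℕ} (hn : n ∈ X.domain) (h : i < n) :
    X.timestamp i < X.timestamp n := by
  induction n with
  | zero => omega
  | succ n ih =>
    have h1 := (hF.isLeast_timestamp hn).1.2
    rcases Nat.lt_succ_iff_lt_or_eq.1 h with h' | rfl
    · exact (ih (domain_lower hn n.le_succ) h').trans h1
    · exact h1

theorem NonZeno.timestamp_lt_iff (hF : X.NonZeno) {i n : ℕ} (hi : i ∈ X.domain)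
    (hn : n ∈ X.domain) : X.timestamp i < X.timestamp n ↔ i < n := by
  constructor
  · intro h
    by_contra h'
    rcases (not_lt.1 h').lt_or_eq with h1 | rfl
    · exact lt_asymm h (hF.timestamp_lt hi h1)
    · exact lt_irrefl _ h
  · exact hF.timestamp_lt hn

theorem NonZeno.timestamp_injOn (hF : X.NonZeno) : Set.InjOn X.timestamp X.domain := by
  intro i hi n hn h
  have h1 := hF.timestamp_lt_iff hi hn
  have h2 := hF.timestamp_lt_iff hn hi
  rw [h] at h1 h2
  simp only [lt_irrefl, false_iff] at h1 h2
  omega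

theorem NonZeno.timestamp_mem (hF : X.NonZeno) {n : ℕ} (hn : n ∈ X.domain) (h : n ≠ 0) :
    X.timestamp n ∈ X.extremities := by
  obtain ⟨m, rfl⟩ := Nat.exists_eq_succ_of_ne_zero h
  exact (hF.isLeast_timestamp hn).1.1

/-- If every timestamp stayed below `t`, the enumeration would never stop and would give infinitely
many extremities up to `t`. Hence some timestamp reaches `t`, and the first to do so cannot jump
over it. -/
theorem NonZeno.exists_timestamp_eq (hF : X.NonZeno) {t : ℝ} (ht : t ∈ X.extremities) :
    ∃ n ∈ X.domain, n ≠ 0 ∧ X.timestamp n = t := by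
  have hex : ∃ n, n ∈ X.domain ∧ t ≤ X.timestamp n := by
    by_contra hcon
    push Not at hcon
    have hall : ∀ n, n ∈ X.domain := by
      intro n
      induction n with
      | zero => exact zero_mem_domain
      | succ n ih => exact succ_mem_domain ih ht (hcon n ih)
    refine Set.infinite_univ (α := ℕ) (Set.Finite.of_finite_image
      (f := fun n => X.timestamp (n + 1)) ((hF.finite_extremities_le t).subset ?_) ?_)
    · rintro _ ⟨n, -, rfl⟩
      exact ⟨hF.timestamp_mem (hall _) n.succ_ne_zero, (hcon _ (hall _)).le⟩
    · intro i _ j _ hij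
      have := hF.timestamp_injOn (hall _) (hall _) hij
      omega
  classical
  obtain ⟨hn, hle⟩ := Nat.find_spec hex
  have hmin := fun m => Nat.find_min hex (m := m)
  generalize Nat.find hex = n at hn hle hmin
  cases n with
  | zero => exact absurd hle (not_le.2 (extremities_pos ht))
  | succ n =>
    have hlt : X.timestamp n < t := by
      by_contra h
      exact hmin n n.lt_succ_self ⟨domain_lower hn n.le_succ, not_lt.1 h⟩
    exact ⟨n + 1, hn, n.succ_ne_zero, le_antisymm ((hF.isLeast_timestamp hn).2 ⟨ht, hlt⟩) hle⟩

theorem NonZeno.le_of_timestamp_lt_succ (hF : X.NonZeno) {n : ℕ} {t : ℝ}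
    (hn : n + 1 ∈ X.domain) (ht : t ∈ X.extremities) (h : t < X.timestamp (n + 1)) :
    t ≤ X.timestamp n := by
  by_contra h'
  exact absurd ((hF.isLeast_timestamp hn).2 ⟨ht, not_le.1 h'⟩) (not_le.2 h)

theorem NonZeno.timestamp_succ_le (hF : X.NonZeno) {n : ℕ} {t : ℝ}
    (hn : n + 1 ∈ X.domain) (ht : t ∈ X.extremities) (h : X.timestamp n < t) :
    X.timestamp (n + 1) ≤ t :=
  (hF.isLeast_timestamp hn).2 ⟨ht, h⟩

theorem NonZeno.bijOn_timestamp (hF : X.NonZeno) :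
    Set.BijOn X.timestamp (X.domain \ {0}) X.extremities := by
  refine ⟨fun n hn => hF.timestamp_mem hn.1 hn.2, hF.timestamp_injOn.mono Set.sdiff_subset,
    fun t ht => ?_⟩
  obtain ⟨n, hn, h0, rfl⟩ := hF.exists_timestamp_eq ht
  exact ⟨n, ⟨hn, h0⟩, rfl⟩

/-! ### The positions of finite and of infinite encodings -/

theorem IsFinite.nonZeno (h : X.IsFinite) : X.NonZeno := fun _ => h.subset fun _ ha => ha.1

theorem IsFinite.finite_extremities (h : X.IsFinite) : X.extremities.Finite := by
  refine ((h.image fun a => a.stime).union (h.image fun a => a.rtime.untopD 0)).subset ?_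
  rintro t ⟨a, ha, h' | h'⟩
  · exact Or.inl ⟨a, ha, h'⟩
  · exact Or.inr ⟨a, ha, by simp [h']⟩

/-- The domain is an initial segment which, without `0`, is in bijection with the extremities; its
length is found by counting. -/
theorem IsFinite.mem_domain_iff (h : X.IsFinite) {n : ℕ} :
    n ∈ X.domain ↔ n < X.extremities.ncard + 1 := by
  have hb := h.nonZeno.bijOn_timestamp
  have hfin : (X.domain \ {0}).Finite := by
    refine Set.Finite.of_finite_image ?_ hb.injOn
    rw [hb.image_eq]
    exact h.finite_extremities
  have hcard : (X.domain \ {0}).ncard = X.extremities.ncard := by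
    rw [← hb.image_eq, hb.injOn.ncard_image]
  have hlow : ∀ n, (n + 1 ∈ X.domain → n + 1 ≤ X.extremities.ncard) ∧
      (n + 1 ∉ X.domain → X.extremities.ncard ≤ n) := by
    intro n
    have hIcc : (Set.Icc 1 n).ncard = n := by
      rw [← Nat.card_coe_set_eq]; simp
    have hIcc' : (Set.Icc 1 (n + 1)).ncard = n + 1 := by
      rw [← Nat.card_coe_set_eq]; simp
    constructor
    · intro hn
      rw [← hcard, ← hIcc']
      refine Set.ncard_le_ncard (fun i hi => ⟨domain_lower hn hi.2, ?_⟩) hfin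
      have := hi.1
      simp; omega
    · intro hn
      rw [← hcard]
      conv_rhs => rw [← hIcc]
      refine Set.ncard_le_ncard (fun i hi => ⟨?_, ?_⟩) (Set.finite_Icc _ _)
      · have : i ≠ 0 := hi.2
        omega
      · by_contra h'
        exact hn (domain_lower hi.1 (by omega))
  cases n with
  | zero => simp [zero_mem_domain]
  | succ n =>
    constructor
    · intro hn
      have := (hlow n).1 hn
      omega
    · intro hn
      by_contra h'
      have := (hlow n).2 h'
      omega

theorem IsOmega.nonZeno (h : X.IsOmega) : X.NonZeno := h.2

/-- A missing position would bound the domain and leave finitely many extremities, hence finitely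
many operations, since start times are distinct. -/
theorem IsOmega.mem_domain (h : X.IsOmega) (n : ℕ) : n ∈ X.domain := by
  by_contra hn
  have hfin : X.extremities.Finite := by
    rw [← h.nonZeno.bijOn_timestamp.image_eq]
    refine Set.Finite.image _ ((Set.finite_Iio n).subset fun i hi => ?_)
    by_contra h'
    exact hn (domain_lower hi.1 (not_lt.1 h'))
  refine h.1 (Set.Finite.of_finite_image (f := fun a => a.stime) (hfin.subset ?_) ?_)
  · rintro _ ⟨a, ha, rfl⟩
    exact ⟨a, ha, Or.inl rfl⟩
  · intro a ha b hb hab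
    exact X.isHistory.stime_inj a ha b hb hab

/-! ## Positions -/

variable (X) in
/-- The position of the start of an operation. -/
noncomputable def pos (a : X.ops) : ℕ := sInf {n | n ∈ X.domain ∧ X.timestamp n = a.1.stime}

variable (X) in
/-- The position `n` stands for the time `e`: it carries that timestamp, or `e = ⊤` and `n` is
the first position without a timestamp. -/
def IsPos (e : WithTop ℝ) (n : ℕ) : Prop :=
  (n ∈ X.domain ∧ (X.timestamp n : WithTop ℝ) = e) ∨
    (e = ⊤ ∧ n ∉ X.domain ∧ ∀ i < n, i ∈ X.domain)

theorem NonZeno.pos_spec (hF : X.NonZeno) (a : X.ops) :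
    X.pos a ∈ X.domain ∧ X.timestamp (X.pos a) = a.1.stime := by
  obtain ⟨n, hn, -, h⟩ := hF.exists_timestamp_eq (stime_mem_extremities a)
  exact Nat.sInf_mem (s := {n | n ∈ X.domain ∧ X.timestamp n = a.1.stime}) ⟨n, hn, h⟩

theorem NonZeno.pos_mem (hF : X.NonZeno) (a : X.ops) : X.pos a ∈ X.domain := (hF.pos_spec a).1

theorem NonZeno.timestamp_pos (hF : X.NonZeno) (a : X.ops) :
    X.timestamp (X.pos a) = a.1.stime := (hF.pos_spec a).2

theorem NonZeno.eq_pos (hF : X.NonZeno) {a : X.ops} {n : ℕ} (hn : n ∈ X.domain)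
    (h : X.timestamp n = a.1.stime) : n = X.pos a :=
  hF.timestamp_injOn hn (hF.pos_mem a) (h.trans (hF.timestamp_pos a).symm)

theorem stime_injective {a b : X.ops} (h : a.1.stime = b.1.stime) : a = b :=
  Subtype.ext (X.isHistory.stime_inj _ a.2 _ b.2 h)

theorem NonZeno.pos_injective (hF : X.NonZeno) : Function.Injective X.pos := fun a b h =>
  stime_injective (by rw [← hF.timestamp_pos a, ← hF.timestamp_pos b, h])

theorem NonZeno.pos_lt_pos (hF : X.NonZeno) {a b : X.ops} :
    X.pos a < X.pos b ↔ a.1.stime < b.1.stime := by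
  rw [← hF.timestamp_lt_iff (hF.pos_mem a) (hF.pos_mem b), hF.timestamp_pos, hF.timestamp_pos]

theorem NonZeno.pos_ne_zero (hF : X.NonZeno) (a : X.ops) : X.pos a ≠ 0 := by
  intro h
  have h1 := hF.timestamp_pos a
  rw [h] at h1
  exact (X.isHistory.stime_pos _ a.2).ne h1

theorem NonZeno.isPos_stime (hF : X.NonZeno) {a : X.ops} {n : ℕ} :
    X.IsPos (a.1.stime : WithTop ℝ) n ↔ n = X.pos a := by
  constructor
  · rintro (⟨hn, h⟩ | ⟨h, -⟩)
    · exact hF.eq_pos hn (WithTop.coe_injective h)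
    · exact absurd h WithTop.coe_ne_top
  · rintro rfl
    exact Or.inl ⟨hF.pos_mem a, congrArg _ (hF.timestamp_pos a)⟩

/-- A time that is infinite or an extremity. -/
def IsTime (X : AbstractExecution P T O V) (e : WithTop ℝ) : Prop :=
  ∀ t : ℝ, e = (t : WithTop ℝ) → t ∈ X.extremities

theorem isTime_stime (a : X.ops) : X.IsTime (a.1.stime : WithTop ℝ) := fun _ ht =>
  WithTop.coe_injective ht ▸ stime_mem_extremities a

theorem isTime_rtime (a : X.ops) : X.IsTime a.1.rtime := fun _ ht => rtime_mem_extremities ht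

/-- The quantifiers have the shape of `trLt`. Existence on the left and universality on the right
make the criterion right whether `⊤` has no position (infinite word) or the first position past the
end (finite word). -/
theorem NonZeno.lt_iff_exists_isPos (hF : X.NonZeno) {e f : WithTop ℝ} (he : X.IsTime e)
    (hf : X.IsTime f) : e < f ↔ ∃ n, X.IsPos e n ∧ ∀ m, X.IsPos f m → n < m := by
  have hex : ∀ t ∈ X.extremities, ∃ n ∈ X.domain, X.IsPos (t : WithTop ℝ) n := by
    intro t ht
    obtain ⟨n, hn, -, rfl⟩ := hF.exists_timestamp_eq ht
    exact ⟨n, hn, Or.inl ⟨hn, rfl⟩⟩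
  constructor
  · intro h
    lift e to ℝ using h.ne_top
    obtain ⟨n, hn, -, rfl⟩ := hF.exists_timestamp_eq (he _ rfl)
    refine ⟨n, Or.inl ⟨hn, rfl⟩, ?_⟩
    rintro m (⟨hm, rfl⟩ | ⟨-, hm, -⟩)
    · exact (hF.timestamp_lt_iff hn hm).1 (WithTop.coe_lt_coe.1 h)
    · by_contra h'
      exact hm (domain_lower hn (not_lt.1 h'))
  · rintro ⟨n, (⟨hn, rfl⟩ | ⟨rfl, hn, hn'⟩), h⟩
    · induction f with
      | top => exact WithTop.coe_lt_top _
      | coe t =>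
        obtain ⟨m, hm, -, rfl⟩ := hF.exists_timestamp_eq (hf _ rfl)
        exact WithTop.coe_lt_coe.2 ((hF.timestamp_lt_iff hn hm).2 (h m (Or.inl ⟨hm, rfl⟩)))
    · induction f with
      | top => exact absurd (h n (Or.inr ⟨rfl, hn, hn'⟩)) (lt_irrefl _)
      | coe t =>
        obtain ⟨m, hm, hpos⟩ := hex t (hf _ rfl)
        exact absurd (domain_lower hm (h m hpos).le) hn

/-! ## Operations of one process -/

theorem rb_of_stime_lt {a b : X.ops} (hp : a.1.proc = b.1.proc) (h : a.1.stime < b.1.stime) :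
    a.1.Rb b.1 := by
  rcases X.isHistory.sequential _ a.2 _ b.2 hp (fun hab => by simp [hab] at h) with h' | h'
  · exact h'
  · have h1 := (X.isHistory.stime_lt_rtime _ b.2).trans h'
    exact absurd (WithTop.coe_lt_coe.1 h1) (lt_asymm h)

theorem stime_lt_of_rb {a b : X.ops} (h : a.1.Rb b.1) : a.1.stime < b.1.stime :=
  WithTop.coe_lt_coe.1 ((X.isHistory.stime_lt_rtime _ a.2).trans h)

theorem rb_trans {a b c : X.ops} (h : a.1.Rb b.1) (h' : b.1.Rb c.1) : a.1.Rb c.1 :=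
  lt_trans h (WithTop.coe_lt_coe.2 (stime_lt_of_rb h'))

theorem proc_ne_of_concurrent {a b : X.ops} (h : a.1.Concurrent b.1) : a.1.proc ≠ b.1.proc := by
  intro hp
  rcases X.isHistory.sequential _ a.2 _ b.2 hp h.1 with h' | h'
  · exact h.2.1 h'
  · exact h.2.2 h'

theorem concurrent_symm {a b : X.ops} (h : a.1.Concurrent b.1) : b.1.Concurrent a.1 :=
  ⟨h.1.symm, h.2.2, h.2.1⟩

theorem lastStarted_unique {p : P} {t : ℝ} {b c : X.ops} (hb : X.LastStarted p t b)
    (hc : X.LastStarted p t c) : b = c :=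
  stime_injective (le_antisymm (hc.2.2 b hb.1 hb.2.1) (hb.2.2 c hc.1 hc.2.1))

/-- A later operation of the process of `b`, started before `a`, would start after `b` returns, so
`b` would return before `a` starts. -/
theorem lastStarted_of_concurrent {a b : X.ops} (h : a.1.Concurrent b.1)
    (hlt : b.1.stime < a.1.stime) : X.LastStarted b.1.proc a.1.stime b := by
  refine ⟨rfl, hlt, fun c hc hca => ?_⟩
  by_contra h'
  exact h.2.2 (lt_trans (rb_of_stime_lt hc.symm (not_le.1 h')) (WithTop.coe_lt_coe.2 hca))

theorem directSucc_unique {p : P} {a b c : X.ops} (hb : X.DirectSucc p a b)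
    (hc : X.DirectSucc p a c) : b = c := by
  rcases lt_trichotomy b.1.stime c.1.stime with h | h | h
  · exact absurd ⟨b, hb.1.trans hc.1.symm, hb.2.1,
      rb_of_stime_lt (hb.1.trans hc.1.symm) h⟩ hc.2.2
  · exact stime_injective h
  · exact absurd ⟨c, hc.1.trans hb.1.symm, hc.2.1,
      rb_of_stime_lt (hc.1.trans hb.1.symm) h⟩ hb.2.2

theorem nthSucc_unique {p : P} {a b c : X.ops} {r : ℕ} (hb : X.NthSucc p a r b)
    (hc : X.NthSucc p a r c) : b = c := by
  induction r generalizing b c with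
  | zero => exact directSucc_unique hb hc
  | succ r ih =>
    obtain ⟨b', hb', hb⟩ := hb
    obtain ⟨c', hc', hc⟩ := hc
    obtain rfl := ih hb' hc'
    exact directSucc_unique hb hc

theorem NthSucc.rb {p : P} {a b : X.ops} {r : ℕ} (h : X.NthSucc p a r b) : a.1.Rb b.1 := by
  induction r generalizing b with
  | zero => exact h.2.1
  | succ r ih =>
    obtain ⟨c, hc, h⟩ := h
    exact rb_trans (ih hc) h.2.1

theorem NthSucc.rb_of_lt {p : P} {a b c : X.ops} {r s : ℕ} (hb : X.NthSucc p a r b)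
    (hc : X.NthSucc p a s c) (h : r < s) : b.1.Rb c.1 := by
  induction s generalizing c with
  | zero => omega
  | succ s ih =>
    obtain ⟨d, hd, hc⟩ := hc
    rcases Nat.lt_succ_iff_lt_or_eq.1 h with h' | rfl
    · exact rb_trans (ih hd h') hc.2.1
    · obtain rfl := nthSucc_unique hb hd
      exact hc.2.1

theorem NthSucc.exists_of_le {p : P} {a c : X.ops} {r s : ℕ} (hc : X.NthSucc p a s c)
    (h : r ≤ s) : ∃ b, X.NthSucc p a r b := by
  induction s generalizing c with
  | zero => exact ⟨c, by rwa [Nat.le_zero.1 h]⟩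
  | succ s ih =>
    rcases Nat.le_succ_iff.1 h with h' | rfl
    · exact ih hc.choose_spec.1 h'
    · exact ⟨c, hc⟩

/-- Strong induction on the position of `b`: among the finitely many operations of its process
strictly between `a` and `b`, the last one has `b` as direct successor. -/
theorem NonZeno.exists_nthSucc (hF : X.NonZeno) {a b : X.ops} (h : a.1.Rb b.1) :
    ∃ r, X.NthSucc b.1.proc a r b := by
  induction hn : X.pos b using Nat.strong_induction_on generalizing b with
  | _ n ih =>
  subst hn
  by_cases hd : X.DirectSucc b.1.proc a b
  · exact ⟨0, hd⟩
  have hne : {n | ∃ c : X.ops, X.pos c = n ∧ c.1.proc = b.1.proc ∧ a.1.Rb c.1 ∧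
      c.1.Rb b.1}.Nonempty := by
    by_contra hcon
    exact hd ⟨rfl, h, fun ⟨c, hc⟩ => hcon ⟨_, c, rfl, hc⟩⟩
  have hfin : {n | ∃ c : X.ops, X.pos c = n ∧ c.1.proc = b.1.proc ∧ a.1.Rb c.1 ∧
      c.1.Rb b.1}.Finite := by
    refine (Set.finite_Iio (X.pos b)).subset ?_
    rintro _ ⟨c, rfl, -, -, hc⟩
    exact hF.pos_lt_pos.2 (stime_lt_of_rb hc)
  obtain ⟨_, ⟨c, rfl, hcp, hac, hcb⟩, hmax⟩ := Set.exists_max_image _ id hfin hne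
  obtain ⟨r, hr⟩ := ih _ (hF.pos_lt_pos.2 (stime_lt_of_rb hcb)) hac rfl
  rw [hcp] at hr
  refine ⟨r + 1, c, hr, rfl, hcb, ?_⟩
  rintro ⟨d, hdp, hcd, hdb⟩
  have := hmax _ ⟨d, rfl, hdp, rb_trans hac hcd, hdb⟩
  exact absurd (hF.pos_lt_pos.2 (stime_lt_of_rb hcd)) (not_lt.2 this)

end AbstractExecution

/-! ### Binary codes and the numbering of the other processes -/

theorem Nat.eq_iff_testBit_clog {n m c : ℕ} (hn : n < c) (hm : m < c) :
    (∀ j : Fin (Nat.clog 2 c), n.testBit j = m.testBit j) ↔ n = m := by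
  refine ⟨fun h => Nat.eq_of_testBit_eq fun j => ?_, fun h _ => by rw [h]⟩
  by_cases hj : j < Nat.clog 2 c
  · exact h ⟨j, hj⟩
  · have hc : c ≤ 2 ^ j := (Nat.le_pow_clog one_lt_two c).trans
      (Nat.pow_le_pow_right two_pos (not_lt.1 hj))
    rw [Nat.testBit_lt_two_pow (hn.trans_le hc), Nat.testBit_lt_two_pow (hm.trans_le hc)]

theorem Enumeration.valueCode_lt {P T O V : Type*} (E : Enumeration P T O V) (u : OpValue V) :
    E.valueCode u < E.nV + 2 := by
  cases u <;> simp [valueCode]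

theorem Enumeration.valueCode_injective {P T O V : Type*} (E : Enumeration P T O V) :
    Function.Injective E.valueCode := by
  intro u w h
  cases u <;> cases w <;> simp_all [valueCode]
  exact E.val.injective (Fin.ext h)

theorem exists_skipProc_eq {m : ℕ} {i i' : Fin m} (h : i' ≠ i) :
    ∃ j, skipProc i j = i' := by
  have hne : i'.val ≠ i.val := fun h' => h (Fin.ext h')
  by_cases hlt : i'.val < i.val
  · exact ⟨⟨i'.val, by omega⟩, by simp [skipProc, hlt]⟩
  · refine ⟨⟨i'.val - 1, by omega⟩, Fin.ext ?_⟩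
    have : ¬ (i'.val - 1 < i.val) := by omega
    simp only [skipProc, this, if_false]
    omega

/-! ## Satisfaction of the translations of atoms -/

namespace AbstractExecution

open Mona

variable {P T O V : Type*} {X : AbstractExecution P T O V} {E : Enumeration P T O V} {k : ℕ}
  {D : Set (Set ℕ)} {v : ℕ → ℕ} {W : E.Lines k ⊕ ℕ → Set ℕ}

variable (X E k) in
/-- The line variables are interpreted by the encoding of `X`. -/
def Reads (W : E.Lines k ⊕ ℕ → Set ℕ) : Prop :=
  ∀ ℓ, W (Sum.inl ℓ) = {n | n ∈ X.domain ∧ X.Bit E k (X.timestamp n) ℓ}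

theorem Reads.update (hW : X.Reads E k W) (A : ℕ) (Q : Set ℕ) :
    X.Reads E k (Function.update W (Sum.inr A) Q) := fun ℓ => by
  rw [Function.update_of_ne Sum.inl_ne_inr, hW ℓ]

theorem Reads.sat_bit (hW : X.Reads E k W) {x : ℕ} {ℓ : E.Lines k} :
    Mona.Sat D v W (E.bit k x ℓ) ↔ v x ∈ X.domain ∧ X.Bit E k (X.timestamp (v x)) ℓ := by
  simp only [Enumeration.bit, Mona.Sat, hW ℓ, Set.mem_ofPred_eq]

/-! ### Process bits, starts and returns -/

theorem eq_of_extremity {a b : X.ops}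
    (h : b.1.stime = a.1.stime ∨ b.1.rtime = (a.1.stime : WithTop ℝ)) : b = a :=
  h.elim stime_injective fun h' => absurd h'.symm (X.isHistory.stime_ne_rtime _ a.2 _ b.2)

/-- The operation active at `n + 1` would already be active at `n` unless it started after the
timestamp of `n`; the next timestamp is then its start. -/
theorem NonZeno.eq_succ_of_active (hF : X.NonZeno) {n : ℕ} {i : Fin E.m}
    (hn : n + 1 ∈ X.domain) (h0 : ¬ X.Bit E k (X.timestamp n) (.active i))
    (h1 : X.Bit E k (X.timestamp (n + 1)) (.active i)) :
    ∃ a : X.ops, E.proc a.1.proc = i ∧ n + 1 = X.pos a := by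
  obtain ⟨a, ha, hle, hlt⟩ := h1
  refine ⟨a, ha, hF.eq_pos hn ?_⟩
  have hgt : X.timestamp n < a.1.stime := by
    by_contra h
    exact h0 ⟨a, ha, not_lt.1 h,
      lt_trans (WithTop.coe_lt_coe.2 (hF.timestamp_lt hn n.lt_succ_self)) hlt⟩
  exact le_antisymm (hF.timestamp_succ_le hn (stime_mem_extremities a) hgt) hle

theorem NonZeno.active_pos (hF : X.NonZeno) (a : X.ops) :
    X.Bit E k (X.timestamp (X.pos a)) (.active (E.proc a.1.proc)) := by
  rw [hF.timestamp_pos]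
  exact ⟨a, rfl, le_rfl, X.isHistory.stime_lt_rtime _ a.2⟩

/-- An operation of the same process active just before `a` would have to return strictly between
two consecutive timestamps. -/
theorem NonZeno.not_active_pred_pos (hF : X.NonZeno) {a : X.ops} {n : ℕ} (h : n + 1 = X.pos a) :
    ¬ X.Bit E k (X.timestamp n) (.active (E.proc a.1.proc)) := by
  rintro ⟨b, hb, hle, hlt⟩
  have hba : b.1.stime < a.1.stime := by
    rw [← hF.timestamp_pos a, ← h]
    exact hle.trans_lt (hF.timestamp_lt (h ▸ hF.pos_mem a) n.lt_succ_self)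
  have hrb := rb_of_stime_lt (E.proc.injective hb) hba
  unfold Operation.Rb at hrb
  lift b.1.rtime to ℝ using hrb.ne_top with r hr
  rw [← hF.timestamp_pos a, ← h, WithTop.coe_lt_coe] at hrb
  exact absurd (WithTop.coe_lt_coe.1 hlt) (not_lt.2
    (hF.le_of_timestamp_lt_succ (h ▸ hF.pos_mem a) (rtime_mem_extremities hr.symm) hrb))

/-- The start of `a` is an extremity of no other operation, so no operation of another process
starts or returns there. -/
theorem NonZeno.active_pred_pos_iff (hF : X.NonZeno) {a : X.ops} {n : ℕ} (h : n + 1 = X.pos a)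
    {i : Fin E.m} (hi : i ≠ E.proc a.1.proc) :
    X.Bit E k (X.timestamp n) (.active i) ↔ X.Bit E k (X.timestamp (n + 1)) (.active i) := by
  have hdom : n + 1 ∈ X.domain := h ▸ hF.pos_mem a
  have hts : X.timestamp (n + 1) = a.1.stime := by rw [h, hF.timestamp_pos]
  have hlt := hF.timestamp_lt hdom n.lt_succ_self
  constructor
  · rintro ⟨b, hb, hbn, hnb⟩
    refine ⟨b, hb, hbn.trans hlt.le, ?_⟩
    by_contra hcon
    rw [not_lt] at hcon
    have hne := X.isHistory.stime_ne_rtime _ a.2 _ b.2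
    have hntop := ne_top_of_le_ne_top WithTop.coe_ne_top hcon
    lift b.1.rtime to ℝ using hntop with r hr
    rw [WithTop.coe_le_coe] at hcon
    refine absurd (hF.le_of_timestamp_lt_succ hdom (rtime_mem_extremities hr.symm)
      (hcon.lt_of_ne fun h' => hne ?_)) (not_le.2 (WithTop.coe_lt_coe.1 hnb))
    rw [h', hts]
  · rintro ⟨b, hb, hbn, hnb⟩
    refine ⟨b, hb, hF.le_of_timestamp_lt_succ hdom (stime_mem_extremities b)
      (hbn.lt_of_ne fun h' => hi ?_), lt_trans (WithTop.coe_lt_coe.2 hlt) hnb⟩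
    rw [← hb, stime_injective (h'.trans hts)]

theorem Reads.sat_startOn (hW : X.Reads E k W) (hF : X.NonZeno) {i : Fin E.m} {x : ℕ} :
    Mona.Sat D v W (E.startOn k i x) ↔ ∃ a : X.ops, E.proc a.1.proc = i ∧ v x = X.pos a := by
  simp only [Enumeration.startOn, Mona.Sat, sat_next, hW.sat_bit, Function.update_self,
    Function.update_of_ne (Nat.lt_succ_self x).ne]
  constructor
  · rintro ⟨n, hn, h0, hdom, h1⟩
    rw [hn] at h1 hdom ⊢
    exact hF.eq_succ_of_active hdom (fun h => h0 ⟨domain_lower hdom n.le_succ, h⟩) h1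
  · rintro ⟨a, rfl, ha⟩
    obtain ⟨n, hn⟩ := Nat.exists_eq_succ_of_ne_zero (hF.pos_ne_zero a)
    refine ⟨n, ha.trans hn, fun h => hF.not_active_pred_pos hn.symm h.2, ?_⟩
    rw [ha]
    exact ⟨hF.pos_mem a, hF.active_pos a⟩

theorem Reads.sat_startOn_pos (hW : X.Reads E k W) (hF : X.NonZeno) {i : Fin E.m} {x : ℕ}
    {a : X.ops} (hx : v x = X.pos a) :
    Mona.Sat D v W (E.startOn k i x) ↔ E.proc a.1.proc = i := by
  rw [hW.sat_startOn hF]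
  constructor
  · rintro ⟨b, hb, h⟩
    rwa [hF.pos_injective (hx.symm.trans h)]
  · exact fun h => ⟨a, h, hx⟩

theorem Reads.sat_isStart (hW : X.Reads E k W) (hF : X.NonZeno) {x : ℕ} :
    Mona.Sat D v W (E.isStart k x) ↔ ∃ a : X.ops, v x = X.pos a := by
  simp only [Enumeration.isStart, Mona.Sat, sat_next, sat_bigOr, sat_bigAnd, hW.sat_bit,
    Function.update_self, Function.update_of_ne (Nat.lt_succ_self x).ne]
  constructor
  · rintro ⟨n, hn, i, ⟨h0, hdom, h1⟩, -⟩
    rw [hn] at h1 hdom ⊢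
    obtain ⟨a, -, ha⟩ := hF.eq_succ_of_active hdom
      (fun h => h0 ⟨domain_lower hdom n.le_succ, h⟩) h1
    exact ⟨a, ha⟩
  · rintro ⟨a, ha⟩
    obtain ⟨n, hn⟩ := Nat.exists_eq_succ_of_ne_zero (hF.pos_ne_zero a)
    have hdom := hF.pos_mem a
    refine ⟨n, ha.trans hn, E.proc a.1.proc, ⟨fun h => hF.not_active_pred_pos hn.symm h.2,
      ha ▸ hdom, ha ▸ hF.active_pos a⟩, fun j => ?_⟩
    split_ifs with hj
    · simp only [Mona.Sat, not_sat_fls, not_false_eq_true]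
    · simp only [sat_iff, hW.sat_bit, Function.update_self,
        Function.update_of_ne (Nat.lt_succ_self x).ne, ha]
      rw [hF.active_pred_pos_iff hn.symm hj, hn]
      rw [hn] at hdom
      simp only [hdom, domain_lower hdom n.le_succ, Nat.succ_eq_add_one]

/-- If `a` still runs at `n`, the process bit at `n + 1` can only come from `a`: another operation
would need the return of `a` to fall strictly between the two timestamps. A return and a new start
of one process therefore never hide each other. -/
theorem NonZeno.active_succ_iff (hF : X.NonZeno) {a : X.ops} {n : ℕ} (hn : n + 1 ∈ X.domain)
    (ha : X.pos a ≤ n) (hlt : (X.timestamp n : WithTop ℝ) < a.1.rtime) :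
    X.Bit E k (X.timestamp (n + 1)) (.active (E.proc a.1.proc)) ↔
      (X.timestamp (n + 1) : WithTop ℝ) < a.1.rtime := by
  have hle : a.1.stime ≤ X.timestamp n := by
    rw [← hF.timestamp_pos a]
    rcases ha.lt_or_eq with h | h
    · exact (hF.timestamp_lt (domain_lower hn n.le_succ) h).le
    · rw [h]
  have hlt' := hF.timestamp_lt hn n.lt_succ_self
  constructor
  · rintro ⟨b, hb, hbn, hnb⟩
    by_cases hab : b = a
    · rwa [← hab]
    · exfalso
      rcases X.isHistory.sequential _ b.2 _ a.2 (E.proc.injective hb)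
        (fun h => hab (Subtype.ext h)) with h | h
      · exact absurd (WithTop.coe_lt_coe.1 (hnb.trans h)) (not_lt.2 (hle.trans hlt'.le))
      · unfold Operation.Rb at h
        lift a.1.rtime to ℝ using h.ne_top with r hr
        rw [WithTop.coe_lt_coe] at h hlt
        exact absurd (hF.le_of_timestamp_lt_succ hn (rtime_mem_extremities hr.symm)
          (h.trans_le hbn)) (not_le.2 hlt)
  · exact fun h => ⟨a, rfl, hle.trans hlt'.le, h⟩

theorem Reads.sat_returnsAt (hW : X.Reads E k W) (hF : X.NonZeno) {x y : ℕ} {a : X.ops}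
    (hx : v x = X.pos a) :
    Mona.Sat D v W (E.returnsAt k x y) ↔ X.IsPos a.1.rtime (v y) := by
  have hiff : Mona.Sat D v W (E.returnsAt k x y) ↔ X.pos a < v y ∧
      ¬ (v y ∈ X.domain ∧ X.Bit E k (X.timestamp (v y)) (.active (E.proc a.1.proc))) ∧
      ∀ n, X.pos a < n → n < v y →
        n ∈ X.domain ∧ X.Bit E k (X.timestamp n) (.active (E.proc a.1.proc)) := by
    simp only [Enumeration.returnsAt, sat_bigOr, Mona.Sat, hW.sat_startOn_pos hF hx, sat_all₁,
      sat_imp, hW.sat_bit, Function.update_self, Function.update_of_ne (left_ne_fresh x y),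
      Function.update_of_ne (right_ne_fresh x y), exists_eq_left', hx, and_imp]
  rw [hiff]
  have hact : ∀ n ∈ X.domain, X.pos a < n → (X.timestamp n : WithTop ℝ) < a.1.rtime →
      X.Bit E k (X.timestamp n) (.active (E.proc a.1.proc)) := by
    intro n hn han h
    refine ⟨a, rfl, ?_, h⟩
    rw [← hF.timestamp_pos a]
    exact (hF.timestamp_lt hn han).le
  have hstart : (X.timestamp (X.pos a) : WithTop ℝ) < a.1.rtime := by
    rw [hF.timestamp_pos]
    exact X.isHistory.stime_lt_rtime _ a.2
  constructor
  · rintro ⟨hlt, hend, hmid⟩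
    generalize v y = y' at hlt hend hmid
    -- The bit alone does not say which operation is active; propagating from the start of `a` shows
    -- that it is `a` all along.
    have key : ∀ n, X.pos a ≤ n → n < y' →
        n ∈ X.domain ∧ (X.timestamp n : WithTop ℝ) < a.1.rtime := by
      intro n hn
      induction n, hn using Nat.le_induction with
      | base => exact fun _ => ⟨hF.pos_mem a, hstart⟩
      | succ n hn ih =>
        intro hny
        obtain ⟨hdom, hbit⟩ := hmid (n + 1) (by omega) hny
        exact ⟨hdom, (hF.active_succ_iff hdom hn (ih (by omega)).2).1 hbit⟩
    obtain ⟨n, rfl⟩ : ∃ n, y' = n + 1 := ⟨y' - 1, by omega⟩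
    obtain ⟨hdn, hn⟩ := key n (by omega) (by omega)
    by_cases hdom : n + 1 ∈ X.domain
    · refine Or.inl ⟨hdom, ?_⟩
      have hge := mt (hF.active_succ_iff (E := E) (k := k) hdom (by omega) hn).2
        fun h => hend ⟨hdom, h⟩
      rw [not_lt] at hge
      refine le_antisymm ?_ hge
      lift a.1.rtime to ℝ using ne_top_of_le_ne_top WithTop.coe_ne_top hge with r hr
      exact WithTop.coe_le_coe.2 (hF.timestamp_succ_le hdom (rtime_mem_extremities hr.symm)
        (WithTop.coe_lt_coe.1 hn))
    -- The word has ended: a finite return time would be a further extremity and extend the domain,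
    -- so `a` is pending.
    · refine Or.inr ⟨?_, hdom, fun i hi => domain_lower hdn (by omega)⟩
      by_contra hne
      lift a.1.rtime to ℝ using hne with r hr
      exact hdom (succ_mem_domain hdn (rtime_mem_extremities hr.symm) (WithTop.coe_lt_coe.1 hn))
  · generalize v y = y'
    rintro (⟨hdom, heq⟩ | ⟨htop, hdom, hlow⟩)
    · rw [← heq, WithTop.coe_lt_coe, hF.timestamp_lt_iff (hF.pos_mem a) hdom] at hstart
      refine ⟨hstart, ?_, fun n han hny => ?_⟩
      · obtain ⟨n, rfl⟩ : ∃ n, y' = n + 1 := ⟨y' - 1, by omega⟩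
        have hn : (X.timestamp n : WithTop ℝ) < a.1.rtime := by
          rw [← heq, WithTop.coe_lt_coe]
          exact hF.timestamp_lt hdom n.lt_succ_self
        rw [hF.active_succ_iff hdom (by omega) hn, heq]
        exact fun h => lt_irrefl _ h.2
      · have hdn := domain_lower hdom hny.le
        refine ⟨hdn, hact n hdn han ?_⟩
        rw [← heq, WithTop.coe_lt_coe]
        exact hF.timestamp_lt hdom hny
    · refine ⟨?_, fun h => hdom h.1, fun n han hny => ⟨hlow n hny, hact n (hlow n hny) han ?_⟩⟩
      · by_contra h
        exact hdom (domain_lower (hF.pos_mem a) (not_lt.1 h))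
      · rw [htop]
        exact WithTop.coe_lt_top _

end AbstractExecution

/-- The time that a term denotes when its variable stands for `a`. -/
def TimeTerm.timeOf {P T O V : Type*} (a : Operation P T O V) : TimeTerm → WithTop ℝ
  | stime _ => a.stime
  | rtime _ => a.rtime

/-- The value that a term denotes when its variable stands for `a`. -/
def ValueTerm.valueOf {P T O V : Type*} (a : Operation P T O V) : ValueTerm → OpValue V
  | ival _ => a.ival
  | oval _ => a.oval

theorem TimeTerm.eval_eq {P T O V : Type*} {X : AbstractExecution P T O V}
    {υ : ℕ → Option X.ops} {s : TimeTerm} {a : X.ops} (h : υ s.var = some a) :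
    s.eval υ = some (s.timeOf a.1) := by
  cases s <;> simp_all [eval, var, timeOf]

theorem ValueTerm.eval_eq {P T O V : Type*} {X : AbstractExecution P T O V}
    {υ : ℕ → Option X.ops} {s : ValueTerm} {a : X.ops} (h : υ s.var = some a) :
    s.eval υ = some (s.valueOf a.1) := by
  cases s <;> simp_all [eval, var, valueOf]

namespace AbstractExecution

open Mona

variable {P T O V : Type*} {X : AbstractExecution P T O V} {E : Enumeration P T O V} {k : ℕ}
  {D : Set (Set ℕ)} {v : ℕ → ℕ} {W : E.Lines k ⊕ ℕ → Set ℕ}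

/-! ### Times, concurrency and attributes -/

theorem isTime_timeOf (s : TimeTerm) (a : X.ops) : X.IsTime (s.timeOf a.1) := by
  cases s
  · exact isTime_stime a
  · exact isTime_rtime a

theorem Reads.sat_timeAt (hW : X.Reads E k W) (hF : X.NonZeno) {s : TimeTerm} {y : ℕ}
    {a : X.ops} (hx : v s.var = X.pos a) :
    Mona.Sat D v W (E.timeAt k s y) ↔ X.IsPos (s.timeOf a.1) (v y) := by
  cases s with
  | stime x =>
    simp only [TimeTerm.var] at hx
    rw [Enumeration.timeAt, sat_eq, TimeTerm.timeOf, hF.isPos_stime, hx, eq_comm]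
  | rtime x => exact hW.sat_returnsAt hF hx

theorem Reads.sat_trLt (hW : X.Reads E k W) (hF : X.NonZeno) {s t : TimeTerm} {a b : X.ops}
    (hs : v s.var = X.pos a) (ht : v t.var = X.pos b) :
    Mona.Sat D v W (E.trLt k s t) ↔ s.timeOf a.1 < t.timeOf b.1 := by
  rw [hF.lt_iff_exists_isPos (isTime_timeOf s a) (isTime_timeOf t b)]
  simp only [Enumeration.trLt, Mona.Sat, sat_all₁, sat_imp]
  refine exists_congr fun n => and_congr ?_ (forall_congr' fun m => ?_)
  · rw [hW.sat_timeAt hF (a := a), Function.update_self]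
    rwa [Function.update_of_ne (left_ne_fresh _ _)]
  · rw [hW.sat_timeAt hF (a := b), Function.update_self, Function.update_of_ne (by omega),
      Function.update_self]
    rwa [Function.update_of_ne (right_ne_fresh_succ _ _),
      Function.update_of_ne (right_ne_fresh _ _)]

theorem Reads.sat_trRb (hW : X.Reads E k W) (hF : X.NonZeno) {x y : ℕ} {a b : X.ops}
    (hx : v x = X.pos a) (hy : v y = X.pos b) :
    Mona.Sat D v W (E.trRb k x y) ↔ a.1.Rb b.1 :=
  hW.sat_trLt hF (s := .rtime x) (t := .stime y) hx hy

theorem Reads.sat_trConc (hW : X.Reads E k W) (hF : X.NonZeno) {x y : ℕ} {a b : X.ops}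
    (hx : v x = X.pos a) (hy : v y = X.pos b) :
    Mona.Sat D v W (E.trConc k x y) ↔ a.1.Concurrent b.1 := by
  simp only [Enumeration.trConc, Mona.Sat, sat_eq, hW.sat_trRb hF hx hy, hW.sat_trRb hF hy hx,
    hx, hy, hF.pos_injective.eq_iff, Operation.Concurrent, ne_eq, Subtype.ext_iff]

theorem Reads.sat_bit_pos (hW : X.Reads E k W) (hF : X.NonZeno) {x : ℕ} {ℓ : E.Lines k}
    {a : X.ops} (hx : v x = X.pos a) :
    Mona.Sat D v W (E.bit k x ℓ) ↔ X.Bit E k a.1.stime ℓ := by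
  rw [hW.sat_bit, hx, hF.timestamp_pos]
  exact and_iff_right (hF.pos_mem a)

theorem Reads.sat_bit_type (hW : X.Reads E k W) (hF : X.NonZeno) {x : ℕ} {a : X.ops}
    (hx : v x = X.pos a) (j) :
    Mona.Sat D v W (E.bit k x (.type j)) ↔ (E.type a.1.type : ℕ).testBit j = true := by
  rw [hW.sat_bit_pos hF hx]
  exact ⟨fun ⟨b, hb, h⟩ => eq_of_extremity hb ▸ h, fun h => ⟨a, Or.inl rfl, h⟩⟩

theorem Reads.sat_bit_obj (hW : X.Reads E k W) (hF : X.NonZeno) {x : ℕ} {a : X.ops}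
    (hx : v x = X.pos a) (j) :
    Mona.Sat D v W (E.bit k x (.obj j)) ↔ (E.obj a.1.obj : ℕ).testBit j = true := by
  rw [hW.sat_bit_pos hF hx]
  exact ⟨fun ⟨b, hb, h⟩ => eq_of_extremity hb ▸ h, fun h => ⟨a, Or.inl rfl, h⟩⟩

theorem Reads.sat_valueBit (hW : X.Reads E k W) (hF : X.NonZeno) {s : ValueTerm} {a : X.ops}
    (hx : v s.var = X.pos a) (j) :
    Mona.Sat D v W (E.valueBit k s j) ↔ (E.valueCode (s.valueOf a.1)).testBit j = true := by
  cases s with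
  | ival x =>
    simp only [ValueTerm.var] at hx
    rw [Enumeration.valueBit, hW.sat_bit_pos hF hx]
    constructor
    · rintro ⟨b, ⟨hb, h⟩ | ⟨hb, -⟩⟩
      · rwa [stime_injective hb] at h
      · exact absurd hb.symm (X.isHistory.stime_ne_rtime _ a.2 _ b.2)
    · exact fun h => ⟨a, Or.inl ⟨rfl, h⟩⟩
  | oval x =>
    simp only [ValueTerm.var] at hx
    have hr : ∀ n : ℕ, Mona.Sat D (Function.update v (x + 1) n) W (E.returnsAt k x (x + 1)) ↔
        X.IsPos a.1.rtime n := by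
      intro n
      rw [hW.sat_returnsAt hF (a := a), Function.update_self]
      rwa [Function.update_of_ne (Nat.lt_succ_self x).ne]
    simp only [Enumeration.valueBit, Mona.Sat, hr, hW.sat_bit, Function.update_self,
      ValueTerm.valueOf]
    constructor
    · rintro ⟨n, hn, hdom, b, ⟨hb, -⟩ | ⟨hb, h⟩⟩
      · rcases hn with ⟨-, hn⟩ | ⟨-, hn, -⟩
        · rw [← hb] at hn
          exact absurd hn (X.isHistory.stime_ne_rtime _ b.2 _ a.2)
        · exact absurd hdom hn
      · rcases hn with ⟨-, hn⟩ | ⟨-, hn, -⟩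
        · rwa [X.isHistory.rtime_inj _ b.2 _ a.2 (hb ▸ WithTop.coe_ne_top) (hb.trans hn)] at h
        · exact absurd hdom hn
    · intro h
      by_cases htop : a.1.rtime = ⊤
      -- A pending operation has value `∇`, whose code `0` has no bit set; this agrees with the
      -- absence of a return letter to read.
      · simp [X.isHistory.oval_of_pending _ a.2 htop, Enumeration.valueCode] at h
      · lift a.1.rtime to ℝ using htop with r hr'
        obtain ⟨n, hn, -, rfl⟩ := hF.exists_timestamp_eq (rtime_mem_extremities hr'.symm)
        exact ⟨n, Or.inl ⟨hn, rfl⟩, hn, a, Or.inr ⟨hr'.symm, h⟩⟩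

theorem Reads.sat_valueIs (hW : X.Reads E k W) (hF : X.NonZeno) {s : ValueTerm} {a : X.ops}
    (hx : v s.var = X.pos a) (u : OpValue V) :
    Mona.Sat D v W (E.valueIs k s (E.valueCode u)) ↔ s.valueOf a.1 = u := by
  simp only [Enumeration.valueIs, sat_bigAnd, sat_lit, hW.sat_valueBit hF hx, Bool.coe_iff_coe,
    Nat.eq_iff_testBit_clog (E.valueCode_lt _) (E.valueCode_lt _), E.valueCode_injective.eq_iff]

/-! ### Arbitration and visibility -/

/-- Here `R` covers the three kinds of pair bits; it is oriented from the operation that starts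
later, so the bit for visibility in the other direction uses a flipped relation. -/
theorem Reads.sat_pairBit (hW : X.Reads E k W) (hF : X.NonZeno) {x y : ℕ} {a b : X.ops}
    (hx : v x = X.pos a) (hy : v y = X.pos b) (hconc : a.1.Concurrent b.1)
    (hlt : b.1.stime < a.1.stime) {ℓ : Fin (E.m - 1) → E.Lines k} {R : X.ops → X.ops → Prop}
    (hℓ : ∀ j, X.Bit E k a.1.stime (ℓ j) ↔ ∃ c d : X.ops, c.1.stime = a.1.stime ∧
      X.LastStarted (E.proc.symm (skipProc (E.proc c.1.proc) j)) a.1.stime d ∧ R c d) :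
    Mona.Sat D v W (E.pairBit k ℓ x y) ↔ R a b := by
  simp only [Enumeration.pairBit, sat_bigOr, Mona.Sat, hW.sat_startOn_pos hF hx,
    hW.sat_startOn_pos hF hy, hW.sat_bit_pos hF hx, hℓ, exists_and_left, exists_eq_left']
  have hlast := lastStarted_of_concurrent hconc hlt
  constructor
  · rintro ⟨j, hj, c, hc, d, hd, h⟩
    obtain rfl := stime_injective hc
    rw [← hj, Equiv.symm_apply_apply] at hd
    rwa [lastStarted_unique hlast hd]
  · intro h
    obtain ⟨j, hj⟩ := exists_skipProc_eq (i := E.proc a.1.proc) (i' := E.proc b.1.proc)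
      fun h => proc_ne_of_concurrent hconc (E.proc.injective h.symm)
    exact ⟨j, hj.symm, a, rfl, b, by rwa [hj, Equiv.symm_apply_apply], h⟩

theorem Reads.sat_trArc (hW : X.Reads E k W) (hF : X.NonZeno) {x y : ℕ} {a b : X.ops}
    (hx : v x = X.pos a) (hy : v y = X.pos b) :
    Mona.Sat D v W (E.trArc k x y) ↔ a.1.Concurrent b.1 ∧ X.ar a b := by
  simp only [Enumeration.trArc, Mona.Sat, sat_or, hW.sat_trConc hF hx hy]
  refine and_congr_right fun hconc => ?_
  rw [hx, hy, hF.pos_lt_pos, hF.pos_lt_pos]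
  have hne : a ≠ b := fun h => hconc.1 (congrArg _ h)
  rcases lt_trichotomy a.1.stime b.1.stime with h | h | h
  · simp only [h, h.not_gt, false_and, true_and, false_or]
    rw [hW.sat_pairBit hF hy hx (concurrent_symm hconc) h (R := X.ar) fun j => Iff.rfl]
    -- The bit at the start of `b` records `ar b a`; its negation is `ar a b` because the order is
    -- total and strict.
    exact ⟨(X.ar_total a b hne).resolve_right, fun h1 h2 => X.ar_irrefl _ (X.ar_trans _ _ _ h1 h2)⟩
  · exact absurd (stime_injective h) hne
  · simp only [h, h.not_gt, false_and, true_and, or_false]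
    exact hW.sat_pairBit hF hx hy hconc h (R := X.ar) fun j => Iff.rfl

theorem RealTimeArbitration.ar_iff (har : X.RealTimeArbitration) {a b : X.ops} :
    X.ar a b ↔ a.1.Rb b.1 ∨ (a.1.Concurrent b.1 ∧ X.ar a b) := by
  constructor
  · intro h
    by_cases hab : a.1.Rb b.1
    · exact Or.inl hab
    · refine Or.inr ⟨⟨fun he => ?_, hab, fun hba => ?_⟩, h⟩
      · rw [Subtype.ext he] at h
        exact X.ar_irrefl _ h
      · exact X.ar_irrefl _ (X.ar_trans _ _ _ h (har _ _ hba))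
  · rintro (h | h)
    · exact har _ _ h
    · exact h.2

/-- By `RealTimeArbitration.ar_iff` the step relation inside the closure is `ar` itself, so the
formula says that `b` lies in every admissible set closed under `ar` steps from `a`. Rebinding the
set variable `0` is harmless, as the body reads no other set variable than the lines. -/
theorem Reads.sat_trAr (hW : X.Reads E k W) (hF : X.NonZeno) (har : X.RealTimeArbitration)
    (hD : ∀ S : Set X.ops, X.pos '' S ∈ D) {x y : ℕ} {a b : X.ops}
    (hx : v x = X.pos a) (hy : v y = X.pos b) :
    Mona.Sat D v W (E.trAr k x y) ↔ X.ar a b := by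
  have hiff : Mona.Sat D v W (E.trAr k x y) ↔ ∀ Q ∈ D,
      (∀ c d : X.ops, (c = a ∨ X.pos c ∈ Q) → X.ar c d → X.pos d ∈ Q) → X.pos b ∈ Q := by
    simp only [Enumeration.trAr, sat_all₂, sat_imp, sat_all₁]
    refine forall₂_congr fun Q _ => ?_
    have hW' := hW.update 0 Q
    refine imp_congr ⟨fun h c d hc hcd => ?_, fun h n m => ?_⟩ (by simp [Mona.Sat, hy])
    · have := h (X.pos c) (X.pos d)
      simp only [Mona.Sat, sat_or, sat_eq, hW'.sat_isStart hF, Function.update_self,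
        Function.update_of_ne (left_ne_fresh_succ x y), Function.update_of_ne (left_ne_fresh x y),
        Function.update_of_ne (Nat.lt_succ_self (fresh x y)).ne, hx] at this
      rw [hW'.sat_trRb hF (a := c) (b := d), hW'.sat_trArc hF (a := c) (b := d),
        ← har.ar_iff] at this
      · exact this ⟨⟨⟨c, rfl⟩, ⟨d, rfl⟩⟩, hc.imp (congrArg _) id, hcd⟩
      all_goals simp
    · simp only [Mona.Sat, sat_or, sat_eq, hW'.sat_isStart hF, Function.update_self,
        Function.update_of_ne (left_ne_fresh_succ x y), Function.update_of_ne (left_ne_fresh x y),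
        Function.update_of_ne (Nat.lt_succ_self (fresh x y)).ne, hx]
      rintro ⟨⟨⟨c, rfl⟩, ⟨d, rfl⟩⟩, hc, hcd⟩
      rw [hW'.sat_trRb hF (a := c) (b := d), hW'.sat_trArc hF (a := c) (b := d),
        ← har.ar_iff] at hcd
      · exact h c d (hc.imp (fun h => hF.pos_injective h) id) hcd
      all_goals simp
  rw [hiff]
  constructor
  · intro h
    -- The smallest such set: the positions of the operations that follow `a`, closed by
    -- transitivity.
    obtain ⟨c, hc, hcb⟩ := h _ (hD {c | X.ar a c}) (by
      rintro c d (rfl | ⟨e, he, hec⟩) hcd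
      · exact ⟨d, hcd, rfl⟩
      · obtain rfl := hF.pos_injective hec
        exact ⟨d, X.ar_trans _ _ _ he hcd, rfl⟩)
    rwa [← hF.pos_injective hcb]
  · exact fun h Q _ hQ => hQ a b (Or.inl rfl) h

theorem Reads.sat_trVisc (hW : X.Reads E k W) (hF : X.NonZeno) {x y : ℕ} {a b : X.ops}
    (hx : v x = X.pos a) (hy : v y = X.pos b) :
    Mona.Sat D v W (E.trVisc k x y) ↔ a.1.Concurrent b.1 ∧ X.vis a b := by
  simp only [Enumeration.trVisc, Mona.Sat, sat_or, hW.sat_trConc hF hx hy]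
  refine and_congr_right fun hconc => ?_
  rw [hx, hy, hF.pos_lt_pos, hF.pos_lt_pos]
  rcases lt_trichotomy a.1.stime b.1.stime with h | h | h
  · simp only [h, h.not_gt, false_and, true_and, false_or]
    rw [hW.sat_pairBit hF hy hx (concurrent_symm hconc) h
      (R := fun c d => c.1.Concurrent d.1 ∧ X.vis d c) fun j => Iff.rfl]
    exact and_iff_right (concurrent_symm hconc)
  · exact absurd (congrArg _ (stime_injective h)) hconc.1
  · simp only [h, h.not_gt, false_and, true_and, or_false]
    rw [hW.sat_pairBit hF hx hy hconc h
      (R := fun c d => c.1.Concurrent d.1 ∧ X.vis c d) fun j => Iff.rfl]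
    exact and_iff_right hconc

/-- Nothing is assumed on `y`, since in the chain formula it is a quantified position; the formula
itself forces it to be a start. -/
theorem Reads.sat_trDirectSucc (hW : X.Reads E k W) (hF : X.NonZeno) {i : Fin E.m} {x y : ℕ}
    {a : X.ops} (hx : v x = X.pos a) :
    Mona.Sat D v W (E.trDirectSucc k i x y) ↔
      ∃ b, v y = X.pos b ∧ X.DirectSucc (E.proc.symm i) a b := by
  simp only [Enumeration.trDirectSucc, Mona.Sat, hW.sat_startOn hF]
  have key : ∀ b : X.ops, E.proc b.1.proc = i → v y = X.pos b →
      ((Mona.Sat D v W (E.trRb k x y) ∧ ¬ ∃ n,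
        (∃ c : X.ops, E.proc c.1.proc = i ∧
          Function.update v (fresh x y) n (fresh x y) = X.pos c) ∧
        Mona.Sat D (Function.update v (fresh x y) n) W (E.trRb k x (fresh x y)) ∧
        Mona.Sat D (Function.update v (fresh x y) n) W (E.trRb k (fresh x y) y)) ↔
      X.DirectSucc (E.proc.symm i) a b) := by
    rintro b rfl hy
    rw [hW.sat_trRb hF hx hy, DirectSucc, Equiv.symm_apply_apply, eq_self_iff_true, true_and]
    refine and_congr_right fun _ => not_congr ?_
    have hx' : ∀ n, Function.update v (fresh x y) n x = X.pos a := fun n => by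
      rwa [Function.update_of_ne (left_ne_fresh x y)]
    have hy' : ∀ n, Function.update v (fresh x y) n y = X.pos b := fun n => by
      rwa [Function.update_of_ne (right_ne_fresh x y)]
    constructor
    · rintro ⟨n, ⟨c, hc, hn⟩, h1, h2⟩
      rw [hW.sat_trRb hF (hx' n) hn] at h1
      rw [hW.sat_trRb hF hn (hy' n)] at h2
      exact ⟨c, E.proc.injective hc, h1, h2⟩
    · rintro ⟨c, hc, h1, h2⟩
      refine ⟨X.pos c, ⟨c, congrArg _ hc, Function.update_self ..⟩, ?_, ?_⟩
      · rwa [hW.sat_trRb hF (hx' _) (Function.update_self ..)]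
      · rwa [hW.sat_trRb hF (Function.update_self ..) (hy' _)]
  constructor
  · rintro ⟨⟨b, hb, hy⟩, h⟩
    exact ⟨b, hy, (key b hb hy).1 h⟩
  · rintro ⟨b, hy, h⟩
    have hb : E.proc b.1.proc = i := by rw [h.1, Equiv.apply_symm_apply]
    exact ⟨⟨b, hb, hy⟩, (key b hb hy).2 h⟩

theorem Reads.sat_trNthSucc (hW : X.Reads E k W) (hF : X.NonZeno) {i : Fin E.m} {x y r : ℕ}
    {a : X.ops} (hx : v x = X.pos a) :
    Mona.Sat D v W (E.trNthSucc k i x r y) ↔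
      ∃ b, v y = X.pos b ∧ X.NthSucc (E.proc.symm i) a r b := by
  induction r generalizing v y with
  | zero => exact hW.sat_trDirectSucc hF hx
  | succ r ih =>
    have hx' : ∀ n, Function.update v (fresh x y) n x = X.pos a := fun n => by
      rwa [Function.update_of_ne (left_ne_fresh x y)]
    simp only [Enumeration.trNthSucc, Mona.Sat, ih (hx' _), Function.update_self]
    constructor
    · rintro ⟨_, ⟨c, rfl, hc⟩, h⟩
      rw [hW.sat_trDirectSucc hF (Function.update_self ..),
        Function.update_of_ne (right_ne_fresh x y)] at h
      obtain ⟨b, hb, h⟩ := h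
      exact ⟨b, hb, c, hc, h⟩
    · rintro ⟨b, hb, c, hc, h⟩
      refine ⟨_, ⟨c, rfl, hc⟩, ?_⟩
      rw [hW.sat_trDirectSucc hF (Function.update_self ..),
        Function.update_of_ne (right_ne_fresh x y)]
      exact ⟨b, hb, h⟩

/-- If `b` has index `s` among the successors of `a` on its process, its visibility is read at index
`s` when `s < k`. Otherwise transience moves it to index `k - 1`, whose operation returns before `b`
starts. -/
theorem Transient.vis_iff (htr : X.Transient k) (hk : 1 ≤ k) (hF : X.NonZeno) {a b : X.ops} :
    (a.1.Rb b.1 ∧ X.vis a b) ↔ ∃ (p : P) (r : Fin k),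
      (∃ c, X.NthSucc p a r c ∧ X.vis a c) ∧
      (X.NthSucc p a r b ∨
        (r.val + 1 = k ∧ b.1.proc = p ∧ ∃ c, X.NthSucc p a r c ∧ c.1.Rb b.1)) := by
  constructor
  · rintro ⟨hab, h⟩
    obtain ⟨s, hs⟩ := hF.exists_nthSucc hab
    by_cases hsk : s < k
    · exact ⟨_, ⟨s, hsk⟩, ⟨b, hs, h⟩, Or.inl hs⟩
    · obtain ⟨c, hc⟩ := hs.exists_of_le (r := k - 1) (by omega)
      exact ⟨_, ⟨k - 1, by omega⟩, ⟨c, hc, (htr a _ s (by omega) c b hc hs).1 h⟩,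
        Or.inr ⟨by simp; omega, rfl, c, hc, hc.rb_of_lt hs (by omega)⟩⟩
  · rintro ⟨p, r, ⟨c, hc, hvis⟩, hb | ⟨hr, rfl, d, hd, hdb⟩⟩
    · exact ⟨hb.rb, nthSucc_unique hc hb ▸ hvis⟩
    · obtain rfl := nthSucc_unique hc hd
      obtain ⟨s, hs⟩ := hF.exists_nthSucc (rb_trans hc.rb hdb)
      -- An index up to `r = k - 1` would place `b` no later than the operation of index `r`, which
      -- returns before `b` starts.
      have hks : k ≤ s := by
        by_contra h
        rcases (show s < r ∨ s = r by omega) with h' | h'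
        · exact absurd (stime_lt_of_rb hdb) (lt_asymm (stime_lt_of_rb (hs.rb_of_lt hc h')))
        · subst h'
          obtain rfl := nthSucc_unique hs hc
          exact lt_irrefl _ (stime_lt_of_rb hdb)
      have hkr : k - 1 = r := by omega
      exact ⟨hs.rb, (htr a _ s hks c b (hkr ▸ hc) hs).2 hvis⟩

theorem Reads.sat_trVisRb (hW : X.Reads E k W) (hF : X.NonZeno) (hk : 1 ≤ k)
    (htr : X.Transient k) {x y : ℕ} {a b : X.ops}
    (hx : v x = X.pos a) (hy : v y = X.pos b) :
    Mona.Sat D v W (E.trVisRb k x y) ↔ a.1.Rb b.1 ∧ X.vis a b := by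
  rw [htr.vis_iff hk hF, E.proc.symm.surjective.exists]
  simp only [Enumeration.trVisRb, sat_bigOr, Mona.Sat, hW.sat_bit_pos hF hx]
  refine exists_congr fun i => exists_congr fun r => and_congr ?_ ?_
  · constructor
    · rintro ⟨c, d, hc, h⟩
      obtain rfl := stime_injective hc
      exact ⟨d, h⟩
    · exact fun ⟨d, h⟩ => ⟨a, d, rfl, h⟩
  have hnth : Mona.Sat D v W (E.trNthSucc k i x r y) ↔ X.NthSucc (E.proc.symm i) a r b := by
    rw [hW.sat_trNthSucc hF hx]
    constructor
    · rintro ⟨c, hc, h⟩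
      rwa [hF.pos_injective (hy.symm.trans hc)]
    · exact fun h => ⟨b, hy, h⟩
  split_ifs with hr
  · have hx' : ∀ n, Function.update v (fresh x y) n x = X.pos a := fun n => by
      rwa [Function.update_of_ne (left_ne_fresh x y)]
    have hy' : ∀ n, Function.update v (fresh x y) n y = X.pos b := fun n => by
      rwa [Function.update_of_ne (right_ne_fresh x y)]
    simp only [sat_or, hnth, Mona.Sat, hW.sat_startOn_pos hF (hy' _),
      hW.sat_trNthSucc hF (hx' _), Function.update_self, exists_and_left, hr, true_and,
      Equiv.eq_symm_apply]
    refine or_congr_right (and_congr_right fun _ => ?_)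
    constructor
    · rintro ⟨_, ⟨c, rfl, hc⟩, h⟩
      rw [hW.sat_trRb hF (Function.update_self ..) (hy' _)] at h
      exact ⟨c, hc, h⟩
    · rintro ⟨c, hc, h⟩
      refine ⟨_, ⟨c, rfl, hc⟩, ?_⟩
      rwa [hW.sat_trRb hF (Function.update_self ..) (hy' _)]
  · simp only [hnth, hr, false_and, or_false]

theorem RealTimeVisibility.vis_iff (hvis : X.RealTimeVisibility) {a b : X.ops} :
    X.vis a b ↔ (a.1.Concurrent b.1 ∧ X.vis a b) ∨ (a.1.Rb b.1 ∧ X.vis a b) := by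
  refine ⟨fun h => ?_, fun h => h.elim And.right And.right⟩
  by_cases hab : a.1.Rb b.1
  · exact Or.inr ⟨hab, h⟩
  · refine Or.inl ⟨⟨fun he => ?_, hab, fun hba => hvis _ _ hba h⟩, h⟩
    rw [Subtype.ext he] at h
    exact X.vis_acyclic _ (.single h)

/-! ### The translation -/

/-- Only free variables are constrained, which lets a quantifier rebind one variable and keep the
rest of the invariant. It also makes the hypotheses on assignments vacuous for a closed formula. -/
theorem Reads.sat_translate (hF : X.NonZeno) (hk : 1 ≤ k) (har : X.RealTimeArbitration)
    (hvis : X.RealTimeVisibility) (htr : X.Transient k)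
    (hD : ∀ S : Set X.ops, X.pos '' S ∈ D) (φ : HistMSO P T O)
    {υ : ℕ → Option X.ops} {Υ : ℕ → Set X.ops} (hW : X.Reads E k W)
    (h₁ : ∀ x ∈ φ.free₁, ∃ a, υ x = some a ∧ v x = X.pos a)
    (h₂ : ∀ A ∈ φ.free₂, W (Sum.inr A) = X.pos '' Υ A) :
    X.Sat υ Υ φ ↔ Mona.Sat D v W (E.translate k φ) := by
  induction φ generalizing v W υ Υ with
  | eqProc x y =>
    obtain ⟨a, ha, hx⟩ := h₁ x (by simp [HistMSO.free₁])
    obtain ⟨b, hb, hy⟩ := h₁ y (by simp [HistMSO.free₁])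
    simp [Sat, Enumeration.translate, sat_bigOr, Mona.Sat, hW.sat_startOn_pos hF hx,
      hW.sat_startOn_pos hF hy, ha, hb, eq_comm]
  | eqType x y =>
    obtain ⟨a, ha, hx⟩ := h₁ x (by simp [HistMSO.free₁])
    obtain ⟨b, hb, hy⟩ := h₁ y (by simp [HistMSO.free₁])
    simp only [Enumeration.translate, sat_bigAnd, sat_iff, hW.sat_bit_type hF hx,
      hW.sat_bit_type hF hy, Bool.coe_iff_coe, Nat.eq_iff_testBit_clog (Fin.is_lt _) (Fin.is_lt _)]
    simp [Sat, ha, hb, Fin.val_inj]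
  | eqObj x y =>
    obtain ⟨a, ha, hx⟩ := h₁ x (by simp [HistMSO.free₁])
    obtain ⟨b, hb, hy⟩ := h₁ y (by simp [HistMSO.free₁])
    simp only [Enumeration.translate, sat_bigAnd, sat_iff, hW.sat_bit_obj hF hx,
      hW.sat_bit_obj hF hy, Bool.coe_iff_coe, Nat.eq_iff_testBit_clog (Fin.is_lt _) (Fin.is_lt _)]
    simp [Sat, ha, hb, Fin.val_inj]
  | eqValue s t =>
    obtain ⟨a, ha, hx⟩ := h₁ s.var (by simp [HistMSO.free₁])
    obtain ⟨b, hb, hy⟩ := h₁ t.var (by simp [HistMSO.free₁])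
    simp only [Enumeration.translate, sat_bigAnd, sat_iff, hW.sat_valueBit hF hx,
      hW.sat_valueBit hF hy, Bool.coe_iff_coe,
      Nat.eq_iff_testBit_clog (E.valueCode_lt _) (E.valueCode_lt _), E.valueCode_injective.eq_iff]
    simp [Sat, ValueTerm.eval_eq ha, ValueTerm.eval_eq hb, eq_comm]
  | eqTime s t =>
    obtain ⟨a, ha, hx⟩ := h₁ s.var (by simp [HistMSO.free₁])
    obtain ⟨b, hb, hy⟩ := h₁ t.var (by simp [HistMSO.free₁])
    simp only [Enumeration.translate, Mona.Sat, hW.sat_trLt hF hx hy, hW.sat_trLt hF hy hx,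
      not_lt, and_comm, ← le_antisymm_iff]
    simp [Sat, TimeTerm.eval_eq ha, TimeTerm.eval_eq hb, eq_comm]
  | ltTime s t =>
    obtain ⟨a, ha, hx⟩ := h₁ s.var (by simp [HistMSO.free₁])
    obtain ⟨b, hb, hy⟩ := h₁ t.var (by simp [HistMSO.free₁])
    simp [Sat, Enumeration.translate, hW.sat_trLt hF hx hy,
      TimeTerm.eval_eq ha, TimeTerm.eval_eq hb]
  | procIs x p =>
    obtain ⟨a, ha, hx⟩ := h₁ x (by simp [HistMSO.free₁])
    simp [Sat, Enumeration.translate, hW.sat_startOn_pos hF hx, ha]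
  | typeIs x τ =>
    obtain ⟨a, ha, hx⟩ := h₁ x (by simp [HistMSO.free₁])
    simp only [Enumeration.translate, sat_bigAnd, sat_lit, hW.sat_bit_type hF hx,
      Bool.coe_iff_coe, Nat.eq_iff_testBit_clog (Fin.is_lt _) (Fin.is_lt _)]
    simp [Sat, ha, Fin.val_inj]
  | objIs x o =>
    obtain ⟨a, ha, hx⟩ := h₁ x (by simp [HistMSO.free₁])
    simp only [Enumeration.translate, sat_bigAnd, sat_lit, hW.sat_bit_obj hF hx,
      Bool.coe_iff_coe, Nat.eq_iff_testBit_clog (Fin.is_lt _) (Fin.is_lt _)]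
    simp [Sat, ha, Fin.val_inj]
  | ivalIsPhi x =>
    obtain ⟨a, ha, hx⟩ := h₁ x (by simp [HistMSO.free₁])
    simp [Sat, Enumeration.translate, hW.sat_valueIs hF (s := .ival x) hx, ha, ValueTerm.valueOf]
  | ovalIsPhi x =>
    obtain ⟨a, ha, hx⟩ := h₁ x (by simp [HistMSO.free₁])
    simp [Sat, Enumeration.translate, hW.sat_valueIs hF (s := .oval x) hx, ha, ValueTerm.valueOf]
  | ovalIsNabla x =>
    obtain ⟨a, ha, hx⟩ := h₁ x (by simp [HistMSO.free₁])
    simp [Sat, Enumeration.translate, hW.sat_valueIs hF (s := .oval x) hx, ha, ValueTerm.valueOf]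
  | or φ ψ ihφ ihψ =>
    rw [Sat, Enumeration.translate, sat_or,
      ihφ hW (fun x hx => h₁ x (Finset.mem_union_left _ hx))
        (fun A hA => h₂ A (Finset.mem_union_left _ hA)),
      ihψ hW (fun x hx => h₁ x (Finset.mem_union_right _ hx))
        (fun A hA => h₂ A (Finset.mem_union_right _ hA))]
  | neg φ ih => rw [Sat, Enumeration.translate, Mona.Sat, ih hW h₁ h₂]
  | all₁ x φ ih =>
    simp only [Sat, Enumeration.translate, sat_all₁, sat_imp, hW.sat_isStart hF,
      Function.update_self, forall_exists_index]
    -- Exchanging the quantifiers eliminates the position, which is determined by the operation.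
    rw [forall_comm]
    simp only [forall_eq]
    refine forall_congr' fun a => ih hW (fun y hy => ?_) h₂
    by_cases hyx : y = x
    · subst hyx
      exact ⟨a, Function.update_self .., Function.update_self ..⟩
    · simp only [Function.update_of_ne hyx]
      exact h₁ y (Finset.mem_erase.2 ⟨hyx, hy⟩)
  | all₂ A φ ih =>
    simp only [Sat, Enumeration.translate, sat_all₂, sat_all₁, sat_imp,
      (hW.update A _).sat_isStart hF, Mona.Sat, Function.update_self]
    have hrec : ∀ S : Set X.ops, X.Sat υ (Function.update Υ A S) φ ↔
        Mona.Sat D v (Function.update W (Sum.inr A) (X.pos '' S)) (E.translate k φ) := by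
      refine fun S => ih (hW.update A _) h₁ fun B hB => ?_
      by_cases hBA : B = A
      · subst hBA
        simp only [Function.update_self]
      · rw [Function.update_of_ne hBA, Function.update_of_ne fun h => hBA (Sum.inr_injective h)]
        exact h₂ B (Finset.mem_erase.2 ⟨hBA, hB⟩)
    constructor
    · intro h Q _ hQ
      -- A set of start positions is the image of a set of operations. Conversely, `hD` ensures that
      -- every such image is in the range of the quantifier.
      have : Q = X.pos '' (X.pos ⁻¹' Q) := by
        refine (Set.image_preimage_eq_of_subset fun n hn => ?_).symm
        obtain ⟨a, ha⟩ := hQ n hn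
        exact ⟨a, ha.symm⟩
      rw [this]
      exact (hrec _).1 (h _)
    · intro h S
      exact (hrec S).2 (h _ (hD S) (by rintro _ ⟨a, -, rfl⟩; exact ⟨a, rfl⟩))
  | mem x A =>
    obtain ⟨a, ha, hx⟩ := h₁ x (by simp [HistMSO.free₁])
    simp [Sat, Enumeration.translate, Mona.Sat, ha, hx, h₂ A (by simp [HistMSO.free₂]),
      hF.pos_injective.eq_iff]
  | ar x y =>
    obtain ⟨a, ha, hx⟩ := h₁ x (by simp [HistMSO.free₁])
    obtain ⟨b, hb, hy⟩ := h₁ y (by simp [HistMSO.free₁])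
    simp [Sat, Enumeration.translate, hW.sat_trAr hF har hD hx hy, ha, hb]
  | vis x y =>
    obtain ⟨a, ha, hx⟩ := h₁ x (by simp [HistMSO.free₁])
    obtain ⟨b, hb, hy⟩ := h₁ y (by simp [HistMSO.free₁])
    simp [Sat, Enumeration.translate, sat_or, hW.sat_trVisc hF hx hy,
      hW.sat_trVisRb hF hk htr hx hy, ← hvis.vis_iff, ha, hb]

/-! ### From the encodings to the theorem -/

theorem IsFinite.reads (h : X.IsFinite)
    (hW : ∀ ℓ, W (Sum.inl ℓ) =
      {i | ∃ hi : i < (X.encFinite E k).length, (X.encFinite E k)[i] ℓ = true}) :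
    X.Reads E k W := by
  intro ℓ
  rw [hW ℓ]
  ext i
  simp [encFinite, letter, h.mem_domain_iff]

theorem IsOmega.reads (h : X.IsOmega)
    (hW : ∀ ℓ, W (Sum.inl ℓ) = {i | X.encOmega E k i ℓ = true}) : X.Reads E k W := by
  intro ℓ
  rw [hW ℓ]
  ext i
  simp [encOmega, letter, h.mem_domain i]

end AbstractExecution

theorem mainTheorem5 {P T O V : Type*} (E : Enumeration P T O V) (k : ℕ) (hk : 1 ≤ k)
    (φ : HistMSO P T O) (hφ : φ.IsClosed) (X : AbstractExecution P T O V)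
    (har : X.RealTimeArbitration) (hvis : X.RealTimeVisibility) (htr : X.Transient k) :
    (X.IsFinite → (X.Models φ ↔ Mona.ModelsFinite (X.encFinite E k) (E.translate k φ))) ∧
    (X.IsOmega → (X.Models φ ↔ Mona.ModelsOmega (X.encOmega E k) (E.translate k φ))) := by
  have h₁ : ∀ v : ℕ → ℕ, ∀ x ∈ φ.free₁, ∃ a : X.ops, none = some a ∧ v x = X.pos a := by
    simp [hφ.1]
  have h₂ : ∀ W : E.Lines k ⊕ ℕ → Set ℕ, ∀ A ∈ φ.free₂,
      W (Sum.inr A) = X.pos '' (∅ : Set X.ops) := by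
    simp [hφ.2]
  refine ⟨fun hX => ?_, fun hX => ?_⟩
  -- With finitely many operations, quantifying over finite sets of positions loses no set of
  -- operations.
  · have hD : ∀ S : Set X.ops, X.pos '' S ∈ {Q : Set ℕ | Q.Finite} := fun S =>
      haveI : Finite X.ops := hX
      S.toFinite.image _
    have key : ∀ v W, X.Reads E k W →
        (X.Models φ ↔ Mona.Sat {Q | Q.Finite} v W (E.translate k φ)) := fun v W hW =>
      hW.sat_translate hX.nonZeno hk har hvis htr hD φ (h₁ v) (h₂ W)
    refine ⟨fun h v W hW => (key v W (hX.reads hW)).1 h, fun h => ?_⟩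
    -- Satisfaction by a word ranges over all interpretations that agree on the lines, so one must
    -- be exhibited; the empty sets and position `0` serve for the irrelevant variables.
    have hW : ∀ ℓ, (Sum.elim (fun ℓ => {i | ∃ hi : i < (X.encFinite E k).length,
        (X.encFinite E k)[i] ℓ = true}) fun _ => ∅ : E.Lines k ⊕ ℕ → Set ℕ) (Sum.inl ℓ) = _ :=
      fun ℓ => rfl
    exact (key (fun _ => 0) _ (hX.reads hW)).2 (h _ _ hW)
  · have key : ∀ v W, X.Reads E k W →
        (X.Models φ ↔ Mona.Sat Set.univ v W (E.translate k φ)) := fun v W hW =>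
      hW.sat_translate hX.nonZeno hk har hvis htr (fun _ => Set.mem_univ _) φ (h₁ v) (h₂ W)
    refine ⟨fun h v W hW => (key v W (hX.reads hW)).1 h, fun h => ?_⟩
    have hW : ∀ ℓ, (Sum.elim (fun ℓ => {i | X.encOmega E k i ℓ = true}) fun _ => ∅ :
        E.Lines k ⊕ ℕ → Set ℕ) (Sum.inl ℓ) = _ := fun ℓ => rfl
    exact (key (fun _ => 0) _ (hX.reads hW)).2 (h _ _ hW)
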